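/- **Conventions.** Algorithms are randomized: they are programs for a random access machine with integer registers and integer memory cells that can toss fair coins. Operations are addition, subtraction, multiplication, integer division, memory access and tests for positivity, and each is charged one unit plus the bit length of the integers involved (logarithmic cost). An algorithm solves a decision problem in time $T$ if on every instance $x$ it halts within cost $T(x)$ for all outcomes of its coin tosses and answers correctly with probability at least $2/3$. - *2-sparse linear regression (2-SLR) in the Euclidean norm.* Given positive integers $d,n$, a matrix $\mathbf A\in\mathbb Q^{d\times n}$, a vector $\mathbf b\in\mathbb Q^{d}$ and a number $\delta\in\mathbb Q$, $\delta>0$ (each number written as numerator and denominator), decide whether there is a vector $\mathbf x\in\mathbb R^n$ with at most $2$ nonzero coordinates such that $\|\mathbf A\mathbf x-\mathbf b\|_2\le\delta$. Let $B$ be the largest bit length of a numerator or denominator occurring in $\mathbf A$, $\mathbf b$, $\delta$. - *Orthogonal Vectors (OV).* Given positive integers $n,d$ and vectors $\mathbf u_1,\dots,\mathbf u_n,\mathbf v_1,\dots,\mathbf v_n\in\{0,1\}^d$, decide whether there are $i,j$ with $\langle \mathbf u_i,\mathbf v_j\rangle=\sum_{l=1}^d \mathbf u_i[l]\,\mathbf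 v_j[l]=0$. The *Orthogonal Vectors Hypothesis* states that for no $\varepsilon>0$ and no constants $C,c$ there is a randomized algorithm that solves OV in time $C\,n^{2-\varepsilon}d^{c}$. - *$k$-SAT.* Given a CNF formula on $n$ variables, without repeated clauses, each clause of size at most $k$, decide whether it is satisfiable. The *Strong Exponential Time Hypothesis (SETH)* states that for every $\varepsilon>0$ there is an integer $k\ge 3$ such that no randomized algorithm solves $k$-SAT on $n$ variables in time $O(2^{(1-\varepsilon)n})$. **Corollary.** Suppose that for some $\varepsilon>0$ and some constants $C,c$ there is a (possibly randomized) algorithm that solves 2-SLR in the Euclidean norm in time $C\,n^{2-\varepsilon}(dB)^{c}$ (in particular, suppose it runs in time $n^{2-\varepsilon}\,\mathrm{poly}(d)$). Then the Orthogonal Vectors Hypothesis is false and SETH is false. -/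

import Mathlib

open scoped ENNReal

namespace FineGrained

noncomputable section

/-! ### Random access machines with logarithmic cost

Algorithms are programs for a random access machine, written in structured form.  The machine has
registers and a memory, all holding integers; memory is addressed by integers.  Every arithmetic
operation, every memory access and every test is charged one unit plus the number of bits of the
integers it handles.  A program can toss fair coins. -/

/-- The number of bits of (the absolute value of) an integer. -/
def bitLen (z : ℤ) : ℕ := z.natAbs.size

/-- A state of the machine: registers, memory and the coins that have not been tossed yet. -/
structure State where
  reg : ℕ → ℤ
  mem : ℤ → ℤ
  coins : ℕ → Bool

/-- Expressions. `load e` is the content of the memory cell whose address is the value of `e`;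
`div` is integer division. -/
inductive Expr where
  | const : ℤ → Expr
  | reg : ℕ → Expr
  | load : Expr → Expr
  | add : Expr → Expr → Expr
  | sub : Expr → Expr → Expr
  | mul : Expr → Expr → Expr
  | div : Expr → Expr → Expr

/-- The value of an expression. -/
def Expr.val (s : State) : Expr → ℤ
  | .const z => z
  | .reg r => s.reg r
  | .load e => s.mem (e.val s)
  | .add e f => e.val s + f.val s
  | .sub e f => e.val s - f.val s
  | .mul e f => e.val s * f.val s
  | .div e f => e.val s / f.val s

/-- The logarithmic cost of evaluating an expression: every node is charged one unit plus the bit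
length of its value (the operands and the addresses are the values of the nodes below it). -/
def Expr.cost (s : State) : Expr → ℕ
  | .const z => 1 + bitLen z
  | .reg r => 1 + bitLen (s.reg r)
  | .load e => e.cost s + (1 + bitLen ((Expr.load e).val s))
  | .add e f => e.cost s + f.cost s + (1 + bitLen ((Expr.add e f).val s))
  | .sub e f => e.cost s + f.cost s + (1 + bitLen ((Expr.sub e f).val s))
  | .mul e f => e.cost s + f.cost s + (1 + bitLen ((Expr.mul e f).val s))
  | .div e f => e.cost s + f.cost s + (1 + bitLen ((Expr.div e f).val s))

/-- Programs. -/
inductive Prog where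
  | skip : Prog
  /-- `assign r e` puts the value of `e` into register `r`. -/
  | assign : ℕ → Expr → Prog
  /-- `store e f` puts the value of `f` into the memory cell with address the value of `e`. -/
  | store : Expr → Expr → Prog
  /-- `flip r` tosses a fair coin and puts the outcome, 0 or 1, into register `r`. -/
  | flip : ℕ → Prog
  | seq : Prog → Prog → Prog
  /-- `ite e p q` runs `p` if the value of `e` is positive, and `q` otherwise. -/
  | ite : Expr → Prog → Prog → Prog
  /-- `loop e p` runs `p` as long as the value of `e` is positive. -/
  | loop : Expr → Prog → Prog

/-- `Exec p s t s'`: the program `p`, started in the state `s`, halts in the state `s'` after a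
computation of total cost `t`. -/
inductive Exec : Prog → State → ℕ → State → Prop where
  | skip (s : State) : Exec .skip s 1 s
  | assign (s : State) (r : ℕ) (e : Expr) :
      Exec (.assign r e) s (e.cost s + 1)
        { s with reg := Function.update s.reg r (e.val s) }
  | store (s : State) (e f : Expr) :
      Exec (.store e f) s (e.cost s + f.cost s + 1)
        { s with mem := Function.update s.mem (e.val s) (f.val s) }
  | flip (s : State) (r : ℕ) :
      Exec (.flip r) s 1
        { s with
          reg := Function.update s.reg r (if s.coins 0 then 1 else 0)
          coins := fun i => s.coins (i + 1) }
  | seq {p q : Prog} {s s' s'' : State} {t t' : ℕ} :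
      Exec p s t s' → Exec q s' t' s'' → Exec (.seq p q) s (t + t') s''
  | ite_pos {e : Expr} {p q : Prog} {s s' : State} {t : ℕ} :
      0 < e.val s → Exec p s t s' → Exec (.ite e p q) s (e.cost s + 1 + t) s'
  | ite_nonpos {e : Expr} {p q : Prog} {s s' : State} {t : ℕ} :
      e.val s ≤ 0 → Exec q s t s' → Exec (.ite e p q) s (e.cost s + 1 + t) s'
  | loop_pos {e : Expr} {p : Prog} {s s' s'' : State} {t t' : ℕ} :
      0 < e.val s → Exec p s t s' → Exec (.loop e p) s' t' s'' →
      Exec (.loop e p) s (e.cost s + 1 + t + t') s''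
  | loop_nonpos {e : Expr} {p : Prog} {s : State} :
      e.val s ≤ 0 → Exec (.loop e p) s (e.cost s + 1) s

/-- The initial state: the input stands in the memory cells `0, 1, 2, …`, and every other memory
cell and every register is `0`. -/
def initState (input : List ℤ) (ω : ℕ → Bool) : State where
  reg := fun _ => 0
  mem := fun a => if 0 ≤ a then input.getD a.toNat 0 else 0
  coins := ω

/-- The law of a sequence of independent fair coin tosses. -/
def coinMeasure : MeasureTheory.Measure (ℕ → Bool) :=
  MeasureTheory.Measure.infinitePi fun _ => (PMF.uniformOfFintype Bool).toMeasure

/-- A decision problem: instances, their encoding as a list of integers, and the YES instances. -/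
structure DecisionProblem where
  Inst : Type
  encode : Inst → List ℤ
  yes : Inst → Prop

/-- `P.SolvableInTime T`: some randomized algorithm solves `P` in time `T`.  On every instance `x`
it halts within cost `T x` for all outcomes of the coin tosses, and its answer (YES if register 0
is positive at the end, NO otherwise) is correct with probability at least `2/3`. -/
def DecisionProblem.SolvableInTime (P : DecisionProblem) (T : P.Inst → ℝ) : Prop :=
  ∃ p : Prog, ∀ x : P.Inst,
    (∀ ω : ℕ → Bool, ∃ (t : ℕ) (s : State),
      Exec p (initState (P.encode x) ω) t s ∧ (t : ℝ) ≤ T x) ∧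
    (2 / 3 : ℝ≥0∞) ≤ coinMeasure {ω | ∃ (t : ℕ) (s : State),
      Exec p (initState (P.encode x) ω) t s ∧ (0 < s.reg 0 ↔ P.yes x)}

/-! ### Sparse linear regression in the Euclidean norm -/

/-- An instance of sparse linear regression, with finitely represented (rational) numbers: a
`d × n` design matrix, a target vector and an error bound. -/
structure SLRInstance where
  d : ℕ
  n : ℕ
  d_pos : 0 < d
  n_pos : 0 < n
  A : Matrix (Fin d) (Fin n) ℚ
  b : Fin d → ℚ
  δ : ℚ
  δ_pos : 0 < δ

/-- The number of bits of the numerator or of the denominator of `q`, whichever is larger. -/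
def ratBits (q : ℚ) : ℕ := max (bitLen q.num) (bitLen q.den)

/-- The largest bit length of a number in the instance. -/
def SLRInstance.bits (I : SLRInstance) : ℕ :=
  max (ratBits I.δ) (max (Finset.univ.sup fun i => ratBits (I.b i))
    (Finset.univ.sup fun i => Finset.univ.sup fun j => ratBits (I.A i j)))

/-- A rational number is written as its numerator followed by its denominator. -/
def encodeRat (q : ℚ) : List ℤ := [q.num, (q.den : ℤ)]

/-- The dimensions, the error bound, the target vector, and the design matrix column by column. -/
def SLRInstance.encode (I : SLRInstance) : List ℤ :=
  [(I.d : ℤ), (I.n : ℤ)] ++ encodeRat I.δ ++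
    (List.ofFn fun i => encodeRat (I.b i)).flatten ++
    (List.ofFn fun j => (List.ofFn fun i => encodeRat (I.A i j)).flatten).flatten

/-- Some real vector `x` with at most `k` nonzero coordinates has `‖A x - b‖₂ ≤ δ`. -/
def SLRInstance.IsYes (k : ℕ) (I : SLRInstance) : Prop :=
  ∃ x : Fin I.n → ℝ, {j | x j ≠ 0}.ncard ≤ k ∧
    ‖(WithLp.toLp 2 ((I.A.map fun q : ℚ => (q : ℝ)).mulVec x - fun i => (I.b i : ℝ)) :
      EuclideanSpace ℝ (Fin I.d))‖ ≤ (I.δ : ℝ)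

/-- The `k`-sparse linear regression problem in the Euclidean norm. -/
def SLR (k : ℕ) : DecisionProblem where
  Inst := SLRInstance
  encode := SLRInstance.encode
  yes := SLRInstance.IsYes k

/-! ### Orthogonal vectors -/

/-- An instance of Orthogonal Vectors: two families of `n` vectors in `{0,1}^d`. -/
structure OVInstance where
  n : ℕ
  d : ℕ
  n_pos : 0 < n
  d_pos : 0 < d
  U : Fin n → Fin d → Bool
  V : Fin n → Fin d → Bool

/-- A `0/1` vector as a list of integers. -/
def encodeBits {d : ℕ} (u : Fin d → Bool) : List ℤ :=
  List.ofFn fun i => if u i then 1 else 0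

/-- The number of vectors, the dimension, the vectors of `U` and the vectors of `V`. -/
def OVInstance.encode (I : OVInstance) : List ℤ :=
  [(I.n : ℤ), (I.d : ℤ)] ++ (List.ofFn fun i => encodeBits (I.U i)).flatten ++
    (List.ofFn fun j => encodeBits (I.V j)).flatten

/-- Some `u` in `U` and some `v` in `V` have inner product `0`. -/
def OVInstance.IsYes (I : OVInstance) : Prop :=
  ∃ i j : Fin I.n, ∑ l : Fin I.d, (I.U i l).toNat * (I.V j l).toNat = 0

/-- The Orthogonal Vectors problem. -/
def OV : DecisionProblem where
  Inst := OVInstance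
  encode := OVInstance.encode
  yes := OVInstance.IsYes

/-- The Orthogonal Vectors Hypothesis: no randomized algorithm solves Orthogonal Vectors in time
`n ^ (2 - ε) * poly(d)` for a constant `ε > 0`. -/
def OVHypothesis : Prop :=
  ¬ ∃ ε : ℝ, 0 < ε ∧ ∃ (C : ℝ) (c : ℕ),
    OV.SolvableInTime fun I : OVInstance => C * (I.n : ℝ) ^ (2 - ε) * (I.d : ℝ) ^ c

/-! ### Satisfiability -/

/-- A CNF formula on the variables `0, …, n - 1`, all of whose clauses have size at most `k`: a
list, without repetition, of clauses; a clause is a list of literals; the literal `(i, true)` is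
the variable `i` and `(i, false)` is its negation. -/
structure KCNF (k : ℕ) where
  n : ℕ
  clauses : List (List (Fin n × Bool))
  nodup : clauses.Nodup
  size_le : ∀ c ∈ clauses, c.length ≤ k

/-- The literals on variable `i` are written as `i + 1` and `-(i + 1)`. -/
def encodeLit {n : ℕ} (l : Fin n × Bool) : ℤ :=
  if l.2 then ((l.1 : ℕ) : ℤ) + 1 else -(((l.1 : ℕ) : ℤ) + 1)

/-- The numbers of variables and of clauses, then every clause, preceded by its length. -/
def KCNF.encode {k : ℕ} (φ : KCNF k) : List ℤ :=
  [(φ.n : ℤ), (φ.clauses.length : ℤ)] ++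
    (φ.clauses.map fun c => (c.length : ℤ) :: c.map encodeLit).flatten

/-- Some assignment makes a literal true in every clause. -/
def KCNF.Satisfiable {k : ℕ} (φ : KCNF k) : Prop :=
  ∃ a : Fin φ.n → Bool, ∀ c ∈ φ.clauses, ∃ l ∈ c, a l.1 = l.2

/-- The `k`-SAT problem. -/
def KSAT (k : ℕ) : DecisionProblem where
  Inst := KCNF k
  encode := KCNF.encode
  yes := KCNF.Satisfiable

/-- The Strong Exponential Time Hypothesis: for every `ε > 0` there is `k ≥ 3` such that no
randomized algorithm solves `k`-SAT on `n` variables in time `O(2 ^ ((1 - ε) * n))`. -/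
def SETH : Prop :=
  ∀ ε : ℝ, 0 < ε → ∃ k : ℕ, 3 ≤ k ∧ ¬ ∃ C : ℝ,
    (KSAT k).SolvableInTime fun φ : KCNF k => C * (2 : ℝ) ^ ((1 - ε) * (φ.n : ℝ))

end

end FineGrained

namespace FineGrained

/-! ### Bit lengths -/

/-! Two reductions are chained, from `k`-SAT to OV and from OV to 2-SLR, and each is carried out by
an explicit program whose cost is bounded.

From OV to 2-SLR, the columns are the `2n` vectors times 4, and the target is 2 in each of the `d`
coordinates. If one `u` and one `v` are used with coefficient 1, a coordinate contributes
`(4(u+v)-2)^2`, which is 36 if both bits are 1 and 4 otherwise; the sum is `4d + 32⟨u,v⟩`. Two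
further rows, with entry `24d` on the columns of one side and target `24d`, rule out leaving a side
unused and charge coefficients `1+s`, `1+t` with `(24ds)^2 + (24dt)^2`. Such deviations lower the
sum by at most `48d(|s|+|t|)` (`ov_coord_bound`). Since `x^2 - 2x ≥ -1`, the net gain is at most 2,
too little to make up for the 32 of a common 1. A zero row with target `d-1` turns the threshold
`4d` into `4d + (d-1)^2 = (d+1)^2`, so that the error bound is rational. This is
`OVInstance.toSLR_isYes_iff`.

From SAT to OV, the variables are split by parity, and each of the `N = 2^⌈n/2⌉` assignments of a
half becomes a vector that marks the clauses it leaves unsatisfied. Two halves satisfy the formula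
iff their vectors are orthogonal (`KCNF.toOV_isYes_iff`). For fixed `k` there are polynomially many
distinct clauses, so time `N^(2-ε) poly` is `2^((1-ε/2)n) poly(n)`, and half of the saving absorbs
the polynomial.

On the machine, a reduction must end in exactly the initial state of the new instance, with unused
memory and registers 0 and the coins untouched; then the two programs can be concatenated
(`DecisionProblem.SolvableInTime.of_reduction`). The input is moved to the negative addresses, the
output is written from address 0 on, and the rest is cleared. For the cost, a loop-free block costs
a constant times the bit length of its start state (`Runs.block`), and a loop is described by the
list of its states between iterations (`Runs.loop`, `Runs.emit_loop`). The results are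
`runs_ovToSLRProg` and `runs_satToOVProg`. -/

theorem bitLen_le_iff {z : ℤ} {B : ℕ} : bitLen z ≤ B ↔ z.natAbs < 2 ^ B := Nat.size_le

theorem natAbs_lt_two_pow_bitLen (z : ℤ) : z.natAbs < 2 ^ bitLen z := bitLen_le_iff.1 le_rfl

theorem bitLen_add_le (a b : ℤ) : bitLen (a + b) ≤ bitLen a + bitLen b + 1 := by
  rw [bitLen_le_iff]
  have ha := natAbs_lt_two_pow_bitLen a
  have hb := natAbs_lt_two_pow_bitLen b
  have h1 : 2 ^ bitLen a ≤ 2 ^ (bitLen a + bitLen b) := Nat.pow_le_pow_right (by norm_num) (by omega)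
  have h2 : 2 ^ bitLen b ≤ 2 ^ (bitLen a + bitLen b) := Nat.pow_le_pow_right (by norm_num) (by omega)
  have h3 := Int.natAbs_add_le a b
  rw [pow_succ]
  omega

theorem bitLen_neg (a : ℤ) : bitLen (-a) = bitLen a := by simp [bitLen]

theorem bitLen_sub_le (a b : ℤ) : bitLen (a - b) ≤ bitLen a + bitLen b + 1 := by
  rw [sub_eq_add_neg, ← bitLen_neg b]
  exact bitLen_add_le a (-b)

theorem bitLen_mul_le (a b : ℤ) : bitLen (a * b) ≤ bitLen a + bitLen b := by
  rw [bitLen_le_iff, Int.natAbs_mul, pow_add]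
  exact Nat.mul_lt_mul'' (natAbs_lt_two_pow_bitLen a) (natAbs_lt_two_pow_bitLen b)

theorem bitLen_div_le (a b : ℤ) : bitLen (a / b) ≤ bitLen a := by
  rw [bitLen_le_iff]
  exact (Int.natAbs_ediv_le_natAbs a b).trans_lt (natAbs_lt_two_pow_bitLen a)

/-! ### Cost of expressions and of loop-free programs -/

/-- All integers in the state have at most `B` bits. -/
def Bits (B : ℕ) (s : State) : Prop :=
  (∀ r, bitLen (s.reg r) ≤ B) ∧ ∀ a, bitLen (s.mem a) ≤ B

/-- A factor by which evaluating the expression can exceed the bit length of the state. -/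
def Expr.wt : Expr → ℕ
  | .const z => 1 + bitLen z
  | .reg _ => 2
  | .load e => e.wt + 2
  | .add e f | .sub e f | .mul e f | .div e f => 2 * (e.wt + f.wt) + 2

/-- The root is charged for the length of its own value, so a bound on the cost is also a bound on
the numbers produced. -/
theorem Expr.bitLen_val_le_cost (s : State) (e : Expr) : bitLen (e.val s) ≤ e.cost s := by
  cases e <;> simp only [Expr.cost, Expr.val] <;> omega

/-- An operation yields at most the sum of the lengths of its operands, plus one, and these lengths
are at most the costs of the operands. Hence the doubling at each binary node of `Expr.wt`, and a
bound linear in `B`. -/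
theorem Expr.cost_le {s : State} {B : ℕ} (hB : 1 ≤ B) (h : Bits B s) (e : Expr) :
    e.cost s ≤ e.wt * B := by
  induction e with
  | const z => simp only [Expr.cost, Expr.wt]; exact Nat.le_mul_of_pos_right _ hB
  | reg r => have := h.1 r; simp only [Expr.cost, Expr.wt]; omega
  | load e ih => have := h.2 (e.val s); simp only [Expr.cost, Expr.wt, Expr.val, add_mul]; omega
  | add e f ihe ihf =>
    have := bitLen_add_le (e.val s) (f.val s)
    have h1 := e.bitLen_val_le_cost s
    have h2 := f.bitLen_val_le_cost s
    simp only [Expr.cost, Expr.wt, Expr.val, add_mul, mul_assoc, mul_add]; omega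
  | sub e f ihe ihf =>
    have := bitLen_sub_le (e.val s) (f.val s)
    have h1 := e.bitLen_val_le_cost s
    have h2 := f.bitLen_val_le_cost s
    simp only [Expr.cost, Expr.wt, Expr.val, add_mul, mul_assoc, mul_add]; omega
  | mul e f ihe ihf =>
    have := bitLen_mul_le (e.val s) (f.val s)
    have h1 := e.bitLen_val_le_cost s
    have h2 := f.bitLen_val_le_cost s
    simp only [Expr.cost, Expr.wt, Expr.val, add_mul, mul_assoc, mul_add]; omega
  | div e f ihe ihf =>
    have := bitLen_div_le (e.val s) (f.val s)
    have h1 := e.bitLen_val_le_cost s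
    simp only [Expr.cost, Expr.wt, Expr.val, add_mul, mul_assoc, mul_add]; omega

/-- The state with the value `v` put into register `r`. -/
def State.setReg (s : State) (r : ℕ) (v : ℤ) : State :=
  { s with reg := Function.update s.reg r v }

/-- The state with the value `v` put into the memory cell `a`. -/
def State.setMem (s : State) (a v : ℤ) : State :=
  { s with mem := Function.update s.mem a v }

/-- Programs without loops and coin tosses. -/
def Prog.IsBlock : Prog → Prop
  | .skip | .assign _ _ | .store _ _ => True
  | .seq p q | .ite _ p q => p.IsBlock ∧ q.IsBlock
  | .flip _ | .loop _ _ => False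

/-- The final state of a program without loops and coin tosses. -/
def Prog.ev : Prog → State → State
  | .assign r e, s => s.setReg r (e.val s)
  | .store e f, s => s.setMem (e.val s) (f.val s)
  | .seq p q, s => q.ev (p.ev s)
  | .ite e p q, s => if 0 < e.val s then p.ev s else q.ev s
  | _, s => s

/-- A factor by which running a loop-free program can exceed the bit length of the state. -/
def Prog.wt : Prog → ℕ
  | .assign _ e => e.wt + 1
  | .store e f => e.wt + f.wt + 1
  | .seq p q => p.wt + q.wt * p.wt
  | .ite e p q => e.wt + 1 + p.wt + q.wt
  | _ => 1

theorem Bits.mono {B B' : ℕ} {s : State} (h : Bits B s) (hB : B ≤ B') : Bits B' s :=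
  ⟨fun r => (h.1 r).trans hB, fun a => (h.2 a).trans hB⟩

theorem Bits.setReg {B : ℕ} {s : State} (h : Bits B s) (r : ℕ) {v : ℤ} (hv : bitLen v ≤ B) :
    Bits B (s.setReg r v) := by
  refine ⟨fun r' => ?_, h.2⟩
  simp only [State.setReg, Function.update_apply]
  split_ifs
  exacts [hv, h.1 r']

theorem Bits.setMem {B : ℕ} {s : State} (h : Bits B s) (a : ℤ) {v : ℤ} (hv : bitLen v ≤ B) :
    Bits B (s.setMem a v) := by
  refine ⟨h.1, fun a' => ?_⟩
  simp only [State.setMem, Function.update_apply]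
  split_ifs
  exacts [hv, h.2 a']

theorem Prog.wt_pos (p : Prog) : 1 ≤ p.wt := by
  induction p <;> simp only [Prog.wt] <;> omega

/-! ### Cost bounds for blocks and loops -/

/-- `Runs p s s' T`: started in `s`, the program halts in `s'` within cost `T`. -/
def Runs (p : Prog) (s s' : State) (T : ℕ) : Prop := ∃ t, Exec p s t s' ∧ t ≤ T

theorem Runs.mono {p : Prog} {s s' : State} {T T' : ℕ} (h : Runs p s s' T) (hT : T ≤ T') :
    Runs p s s' T' :=
  let ⟨t, h1, h2⟩ := h
  ⟨t, h1, h2.trans hT⟩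

theorem Runs.seq {p q : Prog} {s s' s'' : State} {T T' : ℕ} (h : Runs p s s' T)
    (h' : Runs q s' s'' T') : Runs (.seq p q) s s'' (T + T') :=
  let ⟨_, h1, h2⟩ := h
  let ⟨_, h3, h4⟩ := h'
  ⟨_, h1.seq h3, Nat.add_le_add h2 h4⟩

/-- Time and growth of the numbers have to be bounded together: the second program of a `seq` starts
from numbers of up to `p.wt * B` bits, which explains the product in `Prog.wt`. -/
theorem Runs.block_aux (p : Prog) : ∀ {s : State} {B : ℕ}, p.IsBlock → 1 ≤ B → Bits B s →
    Runs p s (p.ev s) (p.wt * B) ∧ Bits (p.wt * B) (p.ev s) := by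
  induction p with
  | skip =>
    intro s B _ hB h
    exact ⟨⟨1, .skip s, by simpa [Prog.wt] using hB⟩, by simpa [Prog.wt, Prog.ev] using h⟩
  | assign r e =>
    intro s B _ hB h
    have hc := e.cost_le hB h
    refine ⟨⟨_, .assign s r e, ?_⟩, ?_⟩
    · simp only [Prog.wt, add_mul]; omega
    · refine (h.mono ?_).setReg r ((e.bitLen_val_le_cost s).trans (hc.trans ?_)) <;>
        simp only [Prog.wt, add_mul] <;> omega
  | store e f =>
    intro s B _ hB h
    have hc := e.cost_le hB h
    have hf := f.cost_le hB h
    refine ⟨⟨_, .store s e f, ?_⟩, ?_⟩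
    · simp only [Prog.wt, add_mul]; omega
    · refine (h.mono ?_).setMem _ ((f.bitLen_val_le_cost s).trans (hf.trans ?_)) <;>
        simp only [Prog.wt, add_mul] <;> omega
  | flip r => intro s B h; exact h.elim
  | seq p q ihp ihq =>
    intro s B hb hB h
    obtain ⟨h1, h2⟩ := ihp hb.1 hB h
    obtain ⟨h3, h4⟩ := ihq hb.2 (Nat.mul_pos p.wt_pos hB) h2
    refine ⟨(h1.seq h3).mono ?_, h4.mono ?_⟩
    · simp only [Prog.wt, add_mul, mul_assoc]; omega
    · simp only [Prog.wt, add_mul, mul_assoc]; omega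
  | ite e p q ihp ihq =>
    intro s B hb hB h
    have hc := e.cost_le hB h
    by_cases he : 0 < e.val s
    · obtain ⟨⟨t, h1, h2⟩, h3⟩ := ihp hb.1 hB h
      simp only [Prog.ev, if_pos he]
      refine ⟨⟨_, .ite_pos he h1, ?_⟩, h3.mono ?_⟩ <;> simp only [Prog.wt, add_mul] <;> omega
    · obtain ⟨⟨t, h1, h2⟩, h3⟩ := ihq hb.2 hB h
      simp only [Prog.ev, if_neg he]
      refine ⟨⟨_, .ite_nonpos (not_lt.1 he) h1, ?_⟩, h3.mono ?_⟩ <;>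
        simp only [Prog.wt, add_mul] <;> omega
  | loop e p => intro s B h; exact h.elim

/-- All integers in the state are at most `M` in absolute value. -/
def Small (M : ℕ) (s : State) : Prop :=
  (∀ r, (s.reg r).natAbs ≤ M) ∧ ∀ a, (s.mem a).natAbs ≤ M

theorem Small.bits {M : ℕ} {s : State} (h : Small M s) : Bits M.size s :=
  ⟨fun r => Nat.size_le_size (h.1 r), fun a => Nat.size_le_size (h.2 a)⟩

theorem Runs.block {p : Prog} {s s' : State} {M : ℕ} (hp : p.IsBlock) (hM : 1 ≤ M)
    (h : Small M s) (hs : p.ev s = s') : Runs p s s' (p.wt * M.size) :=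
  hs ▸ (Runs.block_aux p hp (Nat.size_pos.2 hM) h.bits).1

/-- The state before every iteration is given explicitly as `st i`. Because each of these states is
known to be small, the growth factors of the body do not compound over the iterations. -/
theorem Runs.loop {e : Expr} {p : Prog} {M T : ℕ} (hM : 1 ≤ M) (st : ℕ → State) (N : ℕ)
    (hpos : ∀ i < N, 0 < e.val (st i)) (hend : e.val (st N) ≤ 0)
    (hsmall : ∀ i ≤ N, Small M (st i)) (hbody : ∀ i < N, Runs p (st i) (st (i + 1)) T)
    {s s' : State} (h0 : st 0 = s) (hN : st N = s') :
    Runs (.loop e p) s s' ((N + 1) * (T + (e.wt + 1) * M.size)) := by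
  subst h0 hN
  have hsz : 1 ≤ M.size := Nat.size_pos.2 hM
  have hc : ∀ i ≤ N, e.cost (st i) + 1 ≤ (e.wt + 1) * M.size := fun i hi => by
    have := e.cost_le hsz (hsmall i hi).bits
    rw [add_mul]; omega
  -- Induction on the number `k` of iterations still to come, since `Exec` unfolds a loop at its
  -- front.
  have key : ∀ k ≤ N, Runs (.loop e p) (st (N - k)) (st N)
      ((k + 1) * (T + (e.wt + 1) * M.size)) := by
    intro k
    induction k with
    | zero =>
      intro _
      refine ⟨_, .loop_nonpos (by simpa using hend), ?_⟩
      have := hc N le_rfl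
      simp only [Nat.sub_zero]; omega
    | succ k ih =>
      intro hk
      obtain ⟨t', h1, h2⟩ := ih (by omega)
      obtain ⟨t, h3, h4⟩ := hbody (N - (k + 1)) (by omega)
      rw [show N - (k + 1) + 1 = N - k by omega] at h3
      refine ⟨_, .loop_pos (hpos _ (by omega)) h3 h1, ?_⟩
      have := hc (N - (k + 1)) (by omega)
      rw [add_mul (k + 1) 1]; omega
  simpa using key N le_rfl

/-- The time factor of a loop with a loop-free body. -/
def loopWt (e : Expr) (p : Prog) : ℕ := p.wt + (e.wt + 1)

theorem Runs.loop_block {e : Expr} {p : Prog} {M : ℕ} (hp : p.IsBlock) (hM : 1 ≤ M)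
    (st : ℕ → State) (N : ℕ) (hpos : ∀ i < N, 0 < e.val (st i)) (hend : e.val (st N) ≤ 0)
    (hsmall : ∀ i ≤ N, Small M (st i)) (hbody : ∀ i < N, p.ev (st i) = st (i + 1))
    {s s' : State} (h0 : st 0 = s) (hN : st N = s') :
    Runs (.loop e p) s s' ((N + 1) * (loopWt e p * M.size)) := by
  rw [loopWt, add_mul p.wt]
  exact Runs.loop hM st N hpos hend hsmall (fun i hi =>
    Runs.block hp hM (hsmall i hi.le) (hbody i hi)) h0 hN

/-! ### Reductions -/

theorem DecisionProblem.SolvableInTime.mono {P : DecisionProblem} {T T' : P.Inst → ℝ}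
    (h : P.SolvableInTime T) (hT : ∀ x, T x ≤ T' x) : P.SolvableInTime T' := by
  obtain ⟨p, hp⟩ := h
  refine ⟨p, fun x => ⟨fun ω => ?_, (hp x).2⟩⟩
  obtain ⟨t, s, h1, h2⟩ := (hp x).1 ω
  exact ⟨t, s, h1, h2.trans (hT x)⟩

/-- A program that turns the input `x` into the input `f x` reduces one problem to the other. -/
theorem DecisionProblem.SolvableInTime.of_reduction {P Q : DecisionProblem} {T : Q.Inst → ℝ}
    (hQ : Q.SolvableInTime T) (f : P.Inst → Q.Inst) (hf : ∀ x, Q.yes (f x) ↔ P.yes x) (R : Prog)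
    (TR : P.Inst → ℕ)
    (hR : ∀ x ω, Runs R (initState (P.encode x) ω) (initState (Q.encode (f x)) ω) (TR x)) :
    P.SolvableInTime fun x => TR x + T (f x) := by
  obtain ⟨p, hp⟩ := hQ
  refine ⟨.seq R p, fun x => ⟨fun ω => ?_, ?_⟩⟩
  · obtain ⟨t, s, h1, h2⟩ := (hp (f x)).1 ω
    obtain ⟨t', h3, h4⟩ := hR x ω
    refine ⟨_, s, h3.seq h1, ?_⟩
    push_cast
    have : (t' : ℝ) ≤ TR x := by exact_mod_cast h4
    linarith
  -- The reduction tosses no coins and ends with the same `ω`, so the event of a correct answer on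
  -- `f x` is contained in the one for `x`.
  · refine (hp (f x)).2.trans (MeasureTheory.measure_mono ?_)
    rintro ω ⟨t, s, h1, h2⟩
    obtain ⟨t', h3, -⟩ := hR x ω
    exact ⟨_, s, h3.seq h1, h2.trans (hf x)⟩

/-! ### Machine states with finitely many registers in use -/

/-- The state with register contents `l`, memory `m` and coins `ω`. -/
def listState (l : List ℤ) (m : ℤ → ℤ) (ω : ℕ → Bool) : State :=
  ⟨fun r => l.getD r 0, m, ω⟩

/-- The memory with `g` in the cells `0, 1, 2, …` and `f` in the cells `-1, -2, -3, …`. -/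
def splitMem (f g : ℕ → ℤ) : ℤ → ℤ := fun a => if 0 ≤ a then g a.toNat else f (-1 - a).toNat

theorem listState_reg (l : List ℤ) (m : ℤ → ℤ) (ω : ℕ → Bool) (r : ℕ) :
    (listState l m ω).reg r = l.getD r 0 := rfl

theorem listState_mem (l : List ℤ) (m : ℤ → ℤ) (ω : ℕ → Bool) : (listState l m ω).mem = m := rfl

theorem setReg_listState {l : List ℤ} {r : ℕ} (hr : r < l.length) (m : ℤ → ℤ) (ω : ℕ → Bool)
    (v : ℤ) : (listState l m ω).setReg r v = listState (l.set r v) m ω := by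
  simp only [listState, State.setReg, State.mk.injEq, and_self, and_true]
  funext r'
  rw [Function.update_apply]
  by_cases h : r' = r
  · subst h
    simp [List.getD_eq_getElem?_getD, hr]
  · rw [if_neg h]
    simp [List.getD_eq_getElem?_getD, List.getElem?_set_ne (Ne.symm h)]

theorem setMem_listState (l : List ℤ) (m : ℤ → ℤ) (ω : ℕ → Bool) (a v : ℤ) :
    (listState l m ω).setMem a v = listState l (Function.update m a v) ω := rfl

/-- Lets the registers of an initial state be listed as enough explicit zeros for `List.set` to act
on. -/
theorem listState_eq_nil {l : List ℤ} (h : ∀ v ∈ l, v = 0) (m : ℤ → ℤ) (ω : ℕ → Bool) :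
    listState l m ω = listState [] m ω := by
  simp only [listState, State.mk.injEq, and_self, and_true]
  funext r
  rcases lt_or_ge r l.length with hr | hr
  · simpa [hr] using h _ (List.getElem_mem hr)
  · simp [hr]

theorem initState_eq (input : List ℤ) (ω : ℕ → Bool) :
    initState input ω = listState [] (splitMem (fun _ => 0) fun k => input.getD k 0) ω := by
  simp only [initState, listState, State.mk.injEq, and_true]
  exact ⟨by simp, rfl⟩

theorem Small.listState {M : ℕ} {l : List ℤ} {f g : ℕ → ℤ} (hl : ∀ v ∈ l, v.natAbs ≤ M)
    (hf : ∀ k, (f k).natAbs ≤ M) (hg : ∀ k, (g k).natAbs ≤ M) (ω : ℕ → Bool) :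
    Small M (listState l (splitMem f g) ω) := by
  refine ⟨fun r => ?_, fun a => ?_⟩
  · simp only [FineGrained.listState]
    rcases lt_or_ge r l.length with hr | hr
    · simpa [hr] using hl _ (List.getElem_mem hr)
    · simp [hr]
  · simp only [FineGrained.listState, splitMem]
    split_ifs
    exacts [hg _, hf _]

theorem natAbs_getD_le {M : ℕ} {o : List ℤ} (ho : ∀ v ∈ o, v.natAbs ≤ M) (k : ℕ) :
    (o.getD k 0).natAbs ≤ M := by
  rcases lt_or_ge k o.length with hr | hr
  · simpa [hr] using ho _ (List.getElem_mem hr)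
  · simp [hr]

theorem splitMem_neg (f g : ℕ → ℤ) {a : ℤ} {k : ℕ} (h : a = -1 - k) : splitMem f g a = f k := by
  subst h
  rw [splitMem, if_neg (by omega)]
  congr 1
  omega

theorem splitMem_nonneg (f g : ℕ → ℤ) {a : ℤ} {k : ℕ} (h : a = k) : splitMem f g a = g k := by
  subst h
  rw [splitMem, if_pos (by omega)]
  congr 1

theorem update_splitMem_neg (f g : ℕ → ℤ) {a : ℤ} {k : ℕ} (h : a = -1 - k) (v : ℤ) :
    Function.update (splitMem f g) a v = splitMem (Function.update f k v) g := by
  funext x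
  simp only [splitMem, Function.update_apply]
  split_ifs <;> first | rfl | omega

theorem update_splitMem_nonneg (f g : ℕ → ℤ) {a : ℤ} {k : ℕ} (h : a = k) (v : ℤ) :
    Function.update (splitMem f g) a v = splitMem f (Function.update g k v) := by
  funext x
  simp only [splitMem, Function.update_apply]
  split_ifs <;> first | rfl | omega

/-! ### Moving the input away and clearing it -/

/-- Moves a cell to the negative part of the memory; its address is in register 4. -/
def moveCell : Prog :=
  .seq (.store (.sub (.const (-1)) (.reg 4)) (.load (.reg 4)))
    (.seq (.store (.reg 4) (.const 0)) (.assign 4 (.add (.reg 4) (.const 1))))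

/-- Moves the cells `0, …, L - 1` to the cells `-1, …, -L`, where `L` is in register 3; register 4
is the counter. -/
def moveInput : Prog := .loop (.sub (.reg 3) (.reg 4)) moveCell

/-- Clears a cell in the negative part of the memory. -/
def clearCell : Prog :=
  .seq (.store (.sub (.const (-1)) (.reg 4)) (.const 0)) (.assign 4 (.add (.reg 4) (.const 1)))

/-- Clears the cells `-1, …, -L`, where `L` is in register 3; register 4 is the counter. -/
def clearInput : Prog := .loop (.sub (.reg 3) (.reg 4)) clearCell

/-- After `i` iterations the first `i` entries stand mirrored at the addresses `-1, …, -i`, and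
their old cells are 0. By `hf0` nothing is left behind beyond `L`. -/
theorem runs_moveInput {M L : ℕ} {x y z : ℤ} {l : List ℤ} {f : ℕ → ℤ} (hM : 1 ≤ M) (hL : L ≤ M)
    (hl : ∀ v ∈ [x, y, z] ++ l, v.natAbs ≤ M) (hf : ∀ k, (f k).natAbs ≤ M)
    (hf0 : ∀ k, L ≤ k → f k = 0) (ω : ℕ → Bool) :
    Runs moveInput (listState (x :: y :: z :: L :: 0 :: l) (splitMem (fun _ => 0) f) ω)
      (listState (x :: y :: z :: L :: L :: l) (splitMem f fun _ => 0) ω)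
      ((L + 1) * (loopWt (.sub (.reg 3) (.reg 4)) moveCell * M.size)) := by
  refine Runs.loop_block (M := M) (e := .sub (.reg 3) (.reg 4)) (p := moveCell)
    (by simp [moveCell, Prog.IsBlock]) hM
    (fun i => listState (x :: y :: z :: L :: i :: l)
      (splitMem (fun k => if k < i then f k else 0) fun k => if k < i then 0 else f k) ω) L
    (fun i hi => by simp [Expr.val, listState_reg]; omega) (by simp [Expr.val, listState_reg])
    (fun i hi => Small.listState (by simp at hl ⊢; simpa [hL, show i ≤ M by omega] using hl)
      (fun k => by split_ifs <;> simp [hf]) (fun k => by split_ifs <;> simp [hf]) ω)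
    (fun i hi => by
      simp [moveCell, Prog.ev, Expr.val, listState_reg, setMem_listState, setReg_listState,
        listState_mem]
      rw [update_splitMem_neg _ _ rfl, update_splitMem_nonneg _ _ rfl, splitMem_nonneg _ _ rfl]
      congr 2
      · funext k
        simp only [Function.update_apply]
        grind
      · funext k
        simp only [Function.update_apply]
        grind) (by simp) ?_
  congr 2
  · funext k
    grind
  · funext k
    grind

/-- The positive half `g`, which holds the output, is untouched, while the mirrored input is erased
as the next initial state demands. -/
theorem runs_clearInput {M L : ℕ} {x y z : ℤ} {l : List ℤ} {f g : ℕ → ℤ} (hM : 1 ≤ M) (hL : L ≤ M)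
    (hl : ∀ v ∈ [x, y, z] ++ l, v.natAbs ≤ M) (hf : ∀ k, (f k).natAbs ≤ M)
    (hg : ∀ k, (g k).natAbs ≤ M) (hf0 : ∀ k, L ≤ k → f k = 0) (ω : ℕ → Bool) :
    Runs clearInput (listState (x :: y :: z :: L :: 0 :: l) (splitMem f g) ω)
      (listState (x :: y :: z :: L :: L :: l) (splitMem (fun _ => 0) g) ω)
      ((L + 1) * (loopWt (.sub (.reg 3) (.reg 4)) clearCell * M.size)) := by
  refine Runs.loop_block (M := M) (e := .sub (.reg 3) (.reg 4)) (p := clearCell)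
    (by simp [clearCell, Prog.IsBlock]) hM
    (fun i => listState (x :: y :: z :: L :: i :: l)
      (splitMem (fun k => if k < i then 0 else f k) g) ω) L
    (fun i hi => by simp [Expr.val, listState_reg]; omega) (by simp [Expr.val, listState_reg])
    (fun i hi => Small.listState (by simp at hl ⊢; simpa [hL, show i ≤ M by omega] using hl)
      (fun k => by split_ifs <;> simp [hf]) hg ω)
    (fun i hi => by
      simp [clearCell, Prog.ev, Expr.val, listState_reg, setMem_listState, setReg_listState]
      rw [update_splitMem_neg _ _ rfl]
      congr 2
      funext k
      simp only [Function.update_apply]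
      grind) (by simp) ?_
  congr 2
  funext k
  grind

/-! ### Writing the output -/

/-- The state in which the output `o` has been written to the cells `0, 1, 2, …`, register 0 points
to the next free cell, the other registers hold `l`, and the cells `-1, -2, …` hold `f`. -/
def outState (l : List ℤ) (f : ℕ → ℤ) (o : List ℤ) (ω : ℕ → Bool) : State :=
  listState (o.length :: l) (splitMem f fun k => o.getD k 0) ω

/-- Appends a value to the output. -/
def emit (e : Expr) : Prog := .seq (.store (.reg 0) e) (.assign 0 (.add (.reg 0) (.const 1)))

theorem isBlock_emit (e : Expr) : (emit e).IsBlock := ⟨trivial, trivial⟩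

/-- Cells past the end of `o` read 0 through `getD`, so storing at address `o.length` and advancing
the pointer is exactly `o ++ [_]`. -/
theorem ev_emit (e : Expr) (l : List ℤ) (f : ℕ → ℤ) (o : List ℤ) (ω : ℕ → Bool) :
    (emit e).ev (outState l f o ω) = outState l f (o ++ [e.val (outState l f o ω)]) ω := by
  simp only [emit, Prog.ev]
  generalize e.val (outState l f o ω) = v
  simp [outState, Expr.val, listState_reg, setMem_listState, setReg_listState]
  rw [update_splitMem_nonneg _ _ rfl]
  congr 2
  funext k
  simp only [Function.update_apply]
  grind

theorem outState_reg_succ (l : List ℤ) (f : ℕ → ℤ) (o : List ℤ) (ω : ℕ → Bool) (r : ℕ) :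
    (outState l f o ω).reg (r + 1) = l.getD r 0 := rfl

theorem outState_mem (l : List ℤ) (f : ℕ → ℤ) (o : List ℤ) (ω : ℕ → Bool) :
    (outState l f o ω).mem = splitMem f fun k => o.getD k 0 := rfl

theorem setReg_outState {l : List ℤ} {r : ℕ} (hr : r < l.length) (f : ℕ → ℤ) (o : List ℤ)
    (ω : ℕ → Bool) (v : ℤ) :
    (outState l f o ω).setReg (r + 1) v = outState (l.set r v) f o ω := by
  rw [outState, setReg_listState (by simpa using hr)]
  rfl

theorem Small.outState {M : ℕ} {l : List ℤ} {f : ℕ → ℤ} {o : List ℤ}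
    (hl : ∀ v ∈ l, v.natAbs ≤ M) (hf : ∀ k, (f k).natAbs ≤ M) (ho : ∀ v ∈ o, v.natAbs ≤ M)
    (hlen : o.length ≤ M) (ω : ℕ → Bool) : Small M (outState l f o ω) :=
  Small.listState (by simpa [hlen] using hl) hf (natAbs_getD_le ho) ω

section

/-! ### From orthogonal vectors to sparse regression -/

/-- The `l`-th coordinate of the `c`-th vector, where the vectors of `V` come after those of `U`. -/
def OVInstance.bit (I : OVInstance) (c l : ℕ) : Bool :=
  if hl : l < I.d then
    if hc : c < I.n then I.U ⟨c, hc⟩ ⟨l, hl⟩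
    else if hc' : c - I.n < I.n then I.V ⟨c - I.n, hc'⟩ ⟨l, hl⟩ else false
  else false

/-- The design matrix: the scaled vectors, and two rows that force a solution to use one vector of
`U` and one vector of `V`, with coefficients close to `1`. -/
def OVInstance.slrEntry (I : OVInstance) (c l : ℕ) : ℤ :=
  if l < I.d then 4 * (I.bit c l).toNat
  else if l = I.d then if c < I.n then 24 * I.d else 0
  else if l = I.d + 1 then if c < I.n then 0 else 24 * I.d
  else 0

/-- The target vector; its last coordinate makes the error bound an integer. -/
def OVInstance.slrTarget (I : OVInstance) (l : ℕ) : ℤ :=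
  if l < I.d then 2 else if l < I.d + 2 then 24 * I.d else I.d - 1

/-- The instance of sparse regression for an instance of Orthogonal Vectors. -/
def OVInstance.toSLR (I : OVInstance) : SLRInstance where
  d := I.d + 3
  n := I.n + I.n
  d_pos := by omega
  n_pos := Nat.add_pos_left I.n_pos _
  A := fun i j => (I.slrEntry j i : ℚ)
  b := fun i => (I.slrTarget i : ℚ)
  δ := I.d + 1
  δ_pos := by positivity

variable (I : OVInstance)

theorem sum_fin_add_three {d : ℕ} (g : ℕ → ℝ) :
    ∑ r : Fin (d + 3), g r = ∑ l : Fin d, g l + g d + g (d + 1) + g (d + 2) := by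
  simp [Fin.sum_univ_castSucc]

/-- The condition on a solution, written out. -/
theorem OVInstance.toSLR_norm_le_iff (x : Fin (I.n + I.n) → ℝ) :
    ‖(WithLp.toLp 2 ((I.toSLR.A.map fun q : ℚ => (q : ℝ)).mulVec x - fun i => (I.toSLR.b i : ℝ)) :
      EuclideanSpace ℝ (Fin I.toSLR.d))‖ ≤ (I.toSLR.δ : ℝ) ↔
    ∑ l : Fin I.d, (∑ i, 4 * ((I.U i l).toNat : ℝ) * x (Fin.castAdd I.n i) +
        ∑ j, 4 * ((I.V j l).toNat : ℝ) * x (Fin.natAdd I.n j) - 2) ^ 2 +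
      (24 * I.d * ∑ i, x (Fin.castAdd I.n i) - 24 * I.d) ^ 2 +
      (24 * I.d * ∑ j, x (Fin.natAdd I.n j) - 24 * I.d) ^ 2 + ((I.d : ℝ) - 1) ^ 2 ≤
      ((I.d : ℝ) + 1) ^ 2 := by
  have hδ : (I.toSLR.δ : ℝ) = I.d + 1 := by simp [OVInstance.toSLR]
  rw [hδ, ← abs_of_nonneg (show (0 : ℝ) ≤ I.d + 1 by positivity), ← abs_norm, ← sq_le_sq,
    EuclideanSpace.real_norm_sq_eq]
  have hrow : ∀ r : Fin (I.d + 3),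
      ((I.toSLR.A.map fun q : ℚ => (q : ℝ)).mulVec x - fun i => (I.toSLR.b i : ℝ)) r =
      ∑ c : Fin (I.n + I.n), (I.slrEntry c r : ℝ) * x c - I.slrTarget r := by
    intro r
    change ∑ c : Fin (I.n + I.n), ((I.slrEntry c r : ℚ) : ℝ) * x c - ((I.slrTarget r : ℚ) : ℝ) = _
    simp only [Rat.cast_intCast]
  have hsum := sum_fin_add_three (d := I.d) fun r =>
    (∑ c : Fin (I.n + I.n), (I.slrEntry c r : ℝ) * x c - I.slrTarget r) ^ 2
  have hlhs : ∑ r : Fin I.toSLR.d, (((I.toSLR.A.map fun q : ℚ => (q : ℝ)).mulVec x -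
      fun i => (I.toSLR.b i : ℝ)) r) ^ 2 = _ := 
    (Finset.sum_congr rfl fun r _ => congrArg (· ^ 2) (hrow r)).trans hsum
  rw [hlhs]
  simp only [Fin.sum_univ_add]
  have h1 : ∀ (l : Fin I.d) (i : Fin I.n), (I.slrEntry (Fin.castAdd I.n i : Fin (I.n + I.n)) l : ℝ) =
      4 * ((I.U i l).toNat : ℝ) := fun l i => by
    simp [OVInstance.slrEntry, OVInstance.bit]
  have h2 : ∀ (l : Fin I.d) (i : Fin I.n), (I.slrEntry (Fin.natAdd I.n i : Fin (I.n + I.n)) l : ℝ) =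
      4 * ((I.V i l).toNat : ℝ) := fun l i => by
    simp [OVInstance.slrEntry, OVInstance.bit]
  simp only [h1, h2]
  simp [OVInstance.slrEntry, OVInstance.slrTarget, Finset.mul_sum, sub_sq_comm (1 : ℝ) I.d]

/-- At `s = t = 0` the square is 4, or 36 if both bits are 1. The linear term in the deviations is
largest in the latter case, `(6 + 4(s+t))^2 ≥ 36 + 48(s+t)`, which gives the constant 48. -/
theorem ov_coord_bound (u v : Bool) (s t : ℝ) :
    4 + 32 * ((u.toNat * v.toNat : ℕ) : ℝ) - 48 * (|s| + |t|) ≤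
      (4 * u.toNat * (1 + s) + 4 * v.toNat * (1 + t) - 2) ^ 2 := by
  have hs := neg_abs_le s
  have hs' := le_abs_self s
  have ht := neg_abs_le t
  have ht' := le_abs_self t
  cases u <;> cases v <;> simp
  · nlinarith [abs_nonneg s, abs_nonneg t]
  · nlinarith [abs_nonneg s, abs_nonneg t, sq_nonneg t]
  · nlinarith [abs_nonneg s, abs_nonneg t, sq_nonneg s]
  · nlinarith [abs_nonneg s, abs_nonneg t, sq_nonneg (s + t)]

/-- Forward, the two heavy rows force one column from each side, and the coordinate bound excludes a
common 1. Backward, the sum of the two columns has error exactly `(d+1)^2`. -/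
theorem OVInstance.toSLR_isYes_iff : I.toSLR.IsYes 2 ↔ I.IsYes := by
  have hd : (1 : ℝ) ≤ I.d := by exact_mod_cast I.d_pos
  constructor
  · rintro ⟨x, hx, h⟩
    change Fin (I.n + I.n) → ℝ at x
    rw [OVInstance.toSLR_norm_le_iff] at h
    have hsum : 0 ≤ ∑ l : Fin I.d, (∑ i, 4 * ((I.U i l).toNat : ℝ) * x (Fin.castAdd I.n i) +
        ∑ j, 4 * ((I.V j l).toNat : ℝ) * x (Fin.natAdd I.n j) - 2) ^ 2 :=
      Finset.sum_nonneg fun _ _ => sq_nonneg _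
    -- Without a column of `U` the first heavy row alone costs `(24d)^2 > 4d`; likewise for `V`
    -- below.
    obtain ⟨i, hi⟩ : ∃ i, x (Fin.castAdd I.n i) ≠ 0 := by
      by_contra! h0
      rw [Finset.sum_eq_zero (f := fun i => x (Fin.castAdd I.n i)) fun i _ => h0 i, mul_zero] at h
      nlinarith [sq_nonneg (24 * I.d * ∑ j, x (Fin.natAdd I.n j) - 24 * (I.d : ℝ))]
    obtain ⟨j, hj⟩ : ∃ j, x (Fin.natAdd I.n j) ≠ 0 := by
      by_contra! h0
      rw [Finset.sum_eq_zero (f := fun i => x (Fin.natAdd I.n i)) fun i _ => h0 i, mul_zero] at h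
      nlinarith [sq_nonneg (24 * I.d * ∑ j, x (Fin.castAdd I.n j) - 24 * (I.d : ℝ))]
    have hne : Fin.castAdd I.n i ≠ Fin.natAdd I.n j := by
      intro h
      have := congrArg Fin.val h
      simp at this
      omega
    -- Two distinct indices are already in the support, so the sparsity bound leaves no others.
    have hsupp : ({Fin.castAdd I.n i, Fin.natAdd I.n j} : Set (Fin (I.n + I.n))) = {c | x c ≠ 0} := by
      apply Set.eq_of_subset_of_ncard_le
      · rintro c (rfl | rfl) <;> assumption
      · rw [Set.ncard_pair hne]; exact hx
      · exact Set.toFinite _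
    have hzero : ∀ c, c ≠ Fin.castAdd I.n i → c ≠ Fin.natAdd I.n j → x c = 0 := by
      intro c h1 h2
      by_contra h3
      have : c ∈ {c | x c ≠ 0} := h3
      rw [← hsupp] at this
      rcases this with h | h <;> contradiction
    have hU : ∀ g : Fin I.n → ℝ, ∑ i', g i' * x (Fin.castAdd I.n i') =
        g i * x (Fin.castAdd I.n i) := fun g =>
      Finset.sum_eq_single i (fun i' _ hi' => by
        rw [hzero _ (by simpa using hi') (by
          intro h; have := congrArg Fin.val h; simp at this; omega), mul_zero]) (by simp)
    have hV : ∀ g : Fin I.n → ℝ, ∑ i', g i' * x (Fin.natAdd I.n i') =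
        g j * x (Fin.natAdd I.n j) := fun g =>
      Finset.sum_eq_single j (fun i' _ hi' => by
        rw [hzero _ (by
          intro h; have := congrArg Fin.val h; simp at this; omega) (by simpa using hi'),
          mul_zero]) (by simp)
    have hU1 := hU fun _ => 1
    have hV1 := hV fun _ => 1
    simp only [one_mul] at hU1 hV1
    simp only [hU1, hV1, hU (fun i => 4 * ((I.U i _).toNat : ℝ)),
      hV (fun i => 4 * ((I.V i _).toNat : ℝ))] at h
    obtain ⟨s, hs⟩ : ∃ s, x (Fin.castAdd I.n i) = 1 + s := ⟨_, (add_sub_cancel _ _).symm⟩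
    obtain ⟨t, ht⟩ : ∃ t, x (Fin.natAdd I.n j) = 1 + t := ⟨_, (add_sub_cancel _ _).symm⟩
    rw [hs, ht] at h
    have hb : ∑ l : Fin I.d, (4 + 32 * (((I.U i l).toNat * (I.V j l).toNat : ℕ) : ℝ)
        - 48 * (|s| + |t|)) ≤ _ := Finset.sum_le_sum fun l _ => ov_coord_bound (I.U i l) (I.V j l) s t
    rw [Finset.sum_sub_distrib, Finset.sum_add_distrib, ← Finset.mul_sum, ← Nat.cast_sum] at hb
    simp only [Finset.sum_const, Finset.card_univ, Fintype.card_fin, nsmul_eq_mul] at hb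
    refine ⟨i, j, ?_⟩
    by_contra hpos
    have hpos' : (1 : ℝ) ≤ ((∑ l : Fin I.d, (I.U i l).toNat * (I.V j l).toNat : ℕ) : ℝ) := by
      exact_mod_cast Nat.one_le_iff_ne_zero.2 hpos
    -- Completing the squares: `(24d|s|)^2 - 48d|s| ≥ -1`, and the same for `t`, so the error is at
    -- least `4d + 32 - 2 + (d-1)^2 > (d+1)^2`.
    nlinarith [sq_nonneg (24 * I.d * |s| - 1), sq_nonneg (24 * I.d * |t| - 1), sq_abs s, sq_abs t]
  · rintro ⟨i, j, h⟩
    have h2 : ∀ i' j' : Fin I.n, Fin.castAdd I.n i' ≠ Fin.natAdd I.n j' := by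
      intro i' j' h
      have := congrArg Fin.val h
      simp at this
      omega
    have h3 : ∀ i' j' : Fin I.n, Fin.natAdd I.n j' ≠ Fin.castAdd I.n i' := fun i' j' =>
      (h2 i' j').symm
    refine ⟨fun c : Fin (I.n + I.n) =>
      if c = Fin.castAdd I.n i then 1 else if c = Fin.natAdd I.n j then 1 else 0, ?_, ?_⟩
    · refine (Set.ncard_le_ncard (t := {Fin.castAdd I.n i, Fin.natAdd I.n j}) ?_
        (Set.toFinite _)).trans (Set.ncard_pair (h2 i j)).le
      intro c hc
      by_contra hc'
      simp only [Set.mem_insert_iff, Set.mem_singleton_iff, not_or] at hc'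
      exact hc (by simp only [if_neg hc'.1, if_neg hc'.2])
    · rw [OVInstance.toSLR_norm_le_iff]
      simp only [h2, h3, Fin.castAdd_inj, Fin.natAdd_inj, if_false, mul_ite, mul_one, mul_zero,
        Finset.sum_ite_eq', Finset.mem_univ, if_true, sub_self]
      -- At most one of the two bits is 1, so the residual is `-2` or `2`.
      have h1 : ∀ l : Fin I.d,
          (4 * ((I.U i l).toNat : ℝ) + 4 * ((I.V j l).toNat : ℝ) - 2) ^ 2 = 4 := by
        intro l
        have hl := (Finset.sum_eq_zero_iff.1 h) l (Finset.mem_univ l)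
        revert hl
        cases I.U i l <;> cases I.V j l <;> norm_num
      simp only [h1, Finset.sum_const, Finset.card_univ, Fintype.card_fin, nsmul_eq_mul]
      nlinarith

end

/-! ### Loops that write output -/

theorem flatMap_range_prefix {α : Type*} (g : ℕ → List α) {i N : ℕ} (h : i ≤ N) :
    (List.range i).flatMap g <+: (List.range N).flatMap g := by
  obtain ⟨k, rfl⟩ := Nat.exists_eq_add_of_le h
  rw [List.range_add, List.flatMap_append]
  exact List.prefix_append _ _

theorem flatMap_range_succ {α : Type*} (g : ℕ → List α) (i : ℕ) :
    (List.range (i + 1)).flatMap g = (List.range i).flatMap g ++ g i := by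
  simp [List.range_succ]

/-- The numbers `f` in the input and `F` in the output, and the length of the output, are at most
`M`. -/
structure Fits (M : ℕ) (f : ℕ → ℤ) (F : List ℤ) : Prop where
  one_le : 1 ≤ M
  input : ∀ k, (f k).natAbs ≤ M
  output : ∀ v ∈ F, v.natAbs ≤ M
  length : F.length ≤ M

/-- Every partial output is a prefix of the final output `F`, so bounds on `F` alone cover all
intermediate states. -/
theorem Fits.small {M : ℕ} {f : ℕ → ℤ} {F o l : List ℤ} (h : Fits M f F) (ho : o <+: F)
    (hl : ∀ v ∈ l, v.natAbs ≤ M) (ω : ℕ → Bool) : Small M (outState l f o ω) :=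
  Small.outState hl h.input (fun v hv => h.output v (ho.subset hv)) (ho.length_le.trans h.length) ω

/-- Iteration `i` takes the registers from `l i` to `l (i+1)` and appends the chunk `g i`. The test
must not depend on the output written so far, hence the quantifier over `o`; the prefix condition is
handed on to the body so that loops can be nested. -/
theorem Runs.emit_loop {e : Expr} {p : Prog} {M T : ℕ} {f : ℕ → ℤ} {F : List ℤ} (h : Fits M f F)
    {ω : ℕ → Bool} (l : ℕ → List ℤ) (g : ℕ → List ℤ) {o : List ℤ} (N : ℕ)
    (hl : ∀ i ≤ N, ∀ v ∈ l i, v.natAbs ≤ M) (hF : o ++ (List.range N).flatMap g <+: F)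
    (hpos : ∀ i < N, ∀ o, 0 < e.val (outState (l i) f o ω))
    (hend : ∀ o, e.val (outState (l N) f o ω) ≤ 0)
    (hbody : ∀ i < N, ∀ o, o ++ g i <+: F →
      Runs p (outState (l i) f o ω) (outState (l (i + 1)) f (o ++ g i) ω) T)
    {s : State} (h0 : outState (l 0) f o ω = s) :
    Runs (.loop e p) s
      (outState (l N) f (o ++ (List.range N).flatMap g) ω)
      ((N + 1) * (T + (e.wt + 1) * M.size)) := by
  have hpre : ∀ i ≤ N, o ++ (List.range i).flatMap g <+: F := fun i hi =>
    ((List.prefix_append_right_inj o).2 (flatMap_range_prefix g hi)).trans hF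
  refine Runs.loop h.one_le (fun i => outState (l i) f (o ++ (List.range i).flatMap g) ω) N
    (fun i hi => hpos i hi _) (hend _) (fun i hi => h.small (hpre i hi) (hl i hi) ω)
    (fun i hi => ?_) (by simpa using h0) rfl
  have := hbody i hi (o ++ (List.range i).flatMap g)
    (by simpa [flatMap_range_succ] using hpre (i + 1) hi)
  simpa [flatMap_range_succ] using this

theorem Runs.emit_loop_block {e : Expr} {p : Prog} {M : ℕ} {f : ℕ → ℤ} {F : List ℤ}
    (hp : p.IsBlock) (h : Fits M f F) {ω : ℕ → Bool} (l : ℕ → List ℤ) (g : ℕ → List ℤ)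
    {o : List ℤ} (N : ℕ) (hl : ∀ i ≤ N, ∀ v ∈ l i, v.natAbs ≤ M)
    (hF : o ++ (List.range N).flatMap g <+: F)
    (hpos : ∀ i < N, ∀ o, 0 < e.val (outState (l i) f o ω))
    (hend : ∀ o, e.val (outState (l N) f o ω) ≤ 0)
    (hbody : ∀ i < N, ∀ o, p.ev (outState (l i) f o ω) = outState (l (i + 1)) f (o ++ g i) ω)
    {s : State} (h0 : outState (l 0) f o ω = s) :
    Runs (.loop e p) s (outState (l N) f (o ++ (List.range N).flatMap g) ω)
      ((N + 1) * (loopWt e p * M.size)) := by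
  rw [loopWt, add_mul p.wt]
  exact Runs.emit_loop h l g N hl hF hpos hend (fun i hi o ho => Runs.block hp h.one_le
    (h.small ((List.prefix_append _ _).trans ho) (hl i hi.le) ω) (hbody i hi o)) h0

theorem length_flatMap_range {α : Type*} {g : ℕ → List α} {w : ℕ} (hg : ∀ c, (g c).length = w)
    (N : ℕ) : ((List.range N).flatMap g).length = N * w := by
  simp [List.length_flatMap, hg]

theorem getD_flatMap_range {g : ℕ → List ℤ} {w : ℕ} (hg : ∀ c, (g c).length = w) {N c l : ℕ}
    (hc : c < N) (hl : l < w) :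
    ((List.range N).flatMap g).getD (c * w + l) 0 = (g c).getD l 0 := by
  induction N with
  | zero => omega
  | succ N ih =>
    rw [flatMap_range_succ]
    rcases Nat.lt_succ_iff_lt_or_eq.1 hc with h | rfl
    · rw [List.getD_append, ih h]
      rw [length_flatMap_range hg]
      nlinarith
    · rw [List.getD_append_right, length_flatMap_range hg, Nat.add_sub_cancel_left]
      rw [length_flatMap_range hg]
      omega

theorem ofFn_eq_map_range {α : Type*} {n : ℕ} (g : ℕ → α) :
    (List.ofFn fun i : Fin n => g i) = (List.range n).map g := by
  apply List.ext_getElem <;> simp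

/-! ### The encodings of both instances -/

/-- Under the common numbering of `OVInstance.bit` the two families form one array of `2n` rows,
which the program can address by a single index. -/
theorem OVInstance.encode_eq (I : OVInstance) : I.encode =
    [(I.n : ℤ), (I.d : ℤ)] ++ (List.range (I.n + I.n)).flatMap fun c =>
      (List.range I.d).map fun l => ((I.bit c l).toNat : ℤ) := by
  have hU : (fun i => encodeBits (I.U i)) = fun i : Fin I.n =>
      (List.range I.d).map fun l => ((I.bit i l).toNat : ℤ) := by
    funext i
    rw [← ofFn_eq_map_range, encodeBits]
    congr 1
    funext l
    simp only [OVInstance.bit, Fin.is_lt, dite_true]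
    cases I.U i l <;> rfl
  have hV : (fun i => encodeBits (I.V i)) = fun i : Fin I.n =>
      (List.range I.d).map fun l => ((I.bit (I.n + i) l).toNat : ℤ) := by
    funext i
    rw [← ofFn_eq_map_range, encodeBits]
    congr 1
    funext l
    simp [OVInstance.bit]
    cases I.V i l <;> rfl
  rw [OVInstance.encode, hU, hV,
    ofFn_eq_map_range (fun i => (List.range I.d).map fun l => ((I.bit i l).toNat : ℤ)),
    ofFn_eq_map_range (fun i => (List.range I.d).map fun l => ((I.bit (I.n + i) l).toNat : ℤ)),
    List.range_add, List.flatMap_append, ← List.flatMap_def, ← List.flatMap_def,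
    List.flatMap_map, List.append_assoc]

theorem OVInstance.length_encode (I : OVInstance) : I.encode.length = 2 + (I.n + I.n) * I.d := by
  rw [I.encode_eq, List.length_append, length_flatMap_range (w := I.d) (by simp)]
  simp

theorem OVInstance.getD_encode (I : OVInstance) {c l : ℕ} (hc : c < I.n + I.n) (hl : l < I.d) :
    I.encode.getD (2 + (c * I.d + l)) 0 = ((I.bit c l).toNat : ℤ) := by
  rw [I.encode_eq, List.getD_append_right _ _ _ _ (by simp)]
  simp only [List.length_cons, List.length_nil, zero_add, Nat.reduceAdd, Nat.add_sub_cancel_left]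
  rw [getD_flatMap_range (w := I.d) (by simp) hc hl]
  simp [hl]

/-- The beginning of the encoding of the regression instance: dimensions and error bound. -/
def OVInstance.slrHead (I : OVInstance) : List ℤ := [I.d + 3, I.n + I.n, I.d + 1, 1]

/-- The encoding of the target vector. -/
def OVInstance.slrTargetCode (I : OVInstance) : List ℤ :=
  (List.range I.d).flatMap (fun _ => [(2 : ℤ), 1]) ++ [24 * (I.d : ℤ), 1, 24 * I.d, 1, I.d - 1, 1]

/-- The encoding of a column of the design matrix. -/
def OVInstance.slrColCode (I : OVInstance) (c : ℕ) : List ℤ :=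
  (List.range I.d).flatMap (fun l => [4 * ((I.bit c l).toNat : ℤ), 1]) ++
    if c < I.n then [24 * (I.d : ℤ), 1, 0, 1, 0, 1] else [0, 1, 24 * (I.d : ℤ), 1, 0, 1]

theorem flatMap_range_congr {α : Type*} {g g' : ℕ → List α} {N : ℕ} (h : ∀ i < N, g i = g' i) :
    (List.range N).flatMap g = (List.range N).flatMap g' := by
  simp only [List.flatMap_def]
  congr 1
  exact List.map_congr_left fun i hi => h i (List.mem_range.1 hi)

/-- All numbers are integers, so each one is written as itself followed by the denominator 1. The
range of `d + 3` rows is split into the ordinary rows and the three special ones. -/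
theorem OVInstance.encode_toSLR (I : OVInstance) : I.toSLR.encode =
    I.slrHead ++ I.slrTargetCode ++ (List.range (I.n + I.n)).flatMap I.slrColCode := by
  have h0 : ∀ z : ℤ, encodeRat (z : ℚ) = [z, 1] := fun z => by simp [encodeRat]
  have h1 : encodeRat I.toSLR.δ = [(I.d : ℤ) + 1, 1] := by
    have := h0 (I.d + 1)
    push_cast at this
    exact this
  have h2 : (List.ofFn fun i => encodeRat (I.toSLR.b i)).flatten = I.slrTargetCode := by
    have : (fun i => encodeRat (I.toSLR.b i)) = fun i : Fin (I.d + 3) => [I.slrTarget i, 1] :=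
      funext fun i => h0 _
    rw [this]
    change (List.ofFn fun i : Fin (I.d + 3) => [I.slrTarget i, 1]).flatten = _
    rw [ofFn_eq_map_range (fun i => [I.slrTarget i, 1]), ← List.flatMap_def, List.range_add,
      List.flatMap_append, OVInstance.slrTargetCode]
    congr 1
    · exact flatMap_range_congr fun i hi => by simp [OVInstance.slrTarget, hi]
    · simp [List.range_succ, OVInstance.slrTarget]
  have h3 : ∀ j : Fin (I.n + I.n),
      (List.ofFn fun i => encodeRat (I.toSLR.A i j)).flatten = I.slrColCode j := by
    intro j
    have : (fun i => encodeRat (I.toSLR.A i j)) = fun i : Fin (I.d + 3) => [I.slrEntry j i, 1] :=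
      funext fun i => h0 _
    rw [this]
    change (List.ofFn fun i : Fin (I.d + 3) => [I.slrEntry j i, 1]).flatten = _
    rw [ofFn_eq_map_range (fun i => [I.slrEntry j i, 1]), ← List.flatMap_def, List.range_add,
      List.flatMap_append, OVInstance.slrColCode]
    congr 1
    · exact flatMap_range_congr fun i hi => by simp [OVInstance.slrEntry, hi]
    · split_ifs with hj <;> simp [List.range_succ, OVInstance.slrEntry, hj]
  rw [SLRInstance.encode, h1, h2]
  have h4 : (List.ofFn fun j => (List.ofFn fun i => encodeRat (I.toSLR.A i j)).flatten) =
      (List.range (I.n + I.n)).map I.slrColCode := by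
    rw [← ofFn_eq_map_range]
    exact congrArg List.ofFn (funext h3)
  rw [h4, ← List.flatMap_def]
  simp [OVInstance.slrHead, OVInstance.toSLR]

/-! ### The program -/

/-- Reads the dimensions and computes the length of the input. -/
def ovSetup : Prog :=
  .seq (.assign 1 (.load (.const 0))) (.seq (.assign 2 (.load (.const 1)))
    (.assign 3 (.add (.const 2) (.mul (.add (.reg 1) (.reg 1)) (.reg 2)))))

/-- Writes the dimensions and the error bound. -/
def slrWriteHead : Prog :=
  .seq (.assign 4 (.const 0)) (.seq (emit (.add (.reg 2) (.const 3)))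
    (.seq (emit (.add (.reg 1) (.reg 1))) (.seq (emit (.add (.reg 2) (.const 1)))
      (emit (.const 1)))))

/-- Writes an ordinary coordinate of the target vector. -/
def slrWriteTwo : Prog :=
  .seq (emit (.const 2)) (.seq (emit (.const 1)) (.assign 5 (.add (.reg 5) (.const 1))))

/-- Writes the last three coordinates of the target vector. -/
def slrWriteTargetEnd : Prog :=
  .seq (emit (.mul (.const 24) (.reg 2))) (.seq (emit (.const 1))
    (.seq (emit (.mul (.const 24) (.reg 2))) (.seq (emit (.const 1))
      (.seq (emit (.sub (.reg 2) (.const 1))) (.seq (emit (.const 1)) (.assign 5 (.const 0)))))))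

/-- Writes an ordinary entry of the design matrix. -/
def slrWriteEntry : Prog :=
  .seq (emit (.mul (.const 4) (.load (.sub (.const (-3))
      (.add (.mul (.reg 4) (.reg 2)) (.reg 5))))))
    (.seq (emit (.const 1)) (.assign 5 (.add (.reg 5) (.const 1))))

/-- Writes the last three entries of a column of the design matrix. -/
def slrWriteColEnd : Prog :=
  .seq (.ite (.sub (.reg 1) (.reg 4))
      (.seq (emit (.mul (.const 24) (.reg 2))) (.seq (emit (.const 1))
        (.seq (emit (.const 0)) (emit (.const 1)))))
      (.seq (emit (.const 0)) (.seq (emit (.const 1))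
        (.seq (emit (.mul (.const 24) (.reg 2))) (emit (.const 1))))))
    (.seq (emit (.const 0)) (.seq (emit (.const 1))
      (.seq (.assign 5 (.const 0)) (.assign 4 (.add (.reg 4) (.const 1))))))

/-- Writes a column of the design matrix. -/
def slrWriteCol : Prog :=
  .seq (.loop (.sub (.reg 2) (.reg 5)) slrWriteEntry) slrWriteColEnd

/-- Writes the design matrix. -/
def slrWriteCols : Prog := .loop (.sub (.add (.reg 1) (.reg 1)) (.reg 4)) slrWriteCol

/-- Clears the first six registers. -/
def clearSixRegs : Prog :=
  .seq (.assign 0 (.const 0)) (.seq (.assign 1 (.const 0)) (.seq (.assign 2 (.const 0))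
    (.seq (.assign 3 (.const 0)) (.seq (.assign 4 (.const 0)) (.assign 5 (.const 0))))))

/-- Turns an instance of Orthogonal Vectors into one of sparse regression. -/
def ovToSLRProg : Prog :=
  .seq ovSetup (.seq moveInput (.seq slrWriteHead
    (.seq (.loop (.sub (.reg 2) (.reg 5)) slrWriteTwo) (.seq slrWriteTargetEnd
      (.seq slrWriteCols (.seq (.assign 4 (.const 0)) (.seq clearInput clearSixRegs)))))))

theorem runs_slrWriteCol (I : OVInstance) {M L c : ℕ} {F o : List ℤ}
    (h : Fits M (fun k => I.encode.getD k 0) F) (hn : I.n + I.n ≤ M) (hd : I.d ≤ M) (hL : L ≤ M)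
    (hc : c < I.n + I.n) (hF : o ++ I.slrColCode c <+: F) (ω : ℕ → Bool) :
    Runs slrWriteCol (outState [I.n, I.d, L, c, 0] (fun k => I.encode.getD k 0) o ω)
      (outState [I.n, I.d, L, (c + 1 : ℕ), 0] (fun k => I.encode.getD k 0)
        (o ++ I.slrColCode c) ω)
      ((I.d + 1) * (loopWt (.sub (.reg 2) (.reg 5)) slrWriteEntry * M.size) +
        slrWriteColEnd.wt * M.size) := by
  have hF' : o ++ (List.range I.d).flatMap (fun l => [4 * ((I.bit c l).toNat : ℤ), 1]) <+: F := by
    refine List.IsPrefix.trans ?_ hF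
    rw [OVInstance.slrColCode, ← List.append_assoc]
    exact List.prefix_append _ _
  have hl : ∀ t ≤ I.d, ∀ v ∈ [(I.n : ℤ), I.d, L, c, t], v.natAbs ≤ M := by
    intro t ht
    simp
    omega
  refine Runs.seq ?_ (Runs.block (by simp [slrWriteColEnd, Prog.IsBlock, isBlock_emit]) h.one_le
    (h.small hF' (hl I.d le_rfl) ω) ?_)
  · refine Runs.emit_loop_block (by simp [slrWriteEntry, Prog.IsBlock, isBlock_emit]) h
      (fun t => [(I.n : ℤ), I.d, L, c, t]) _ I.d hl hF' (fun t ht o => ?_)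
      (fun o => ?_) (fun t ht o => ?_) (by simp)
    · simp [Expr.val, outState_reg_succ]; omega
    · simp [Expr.val, outState_reg_succ]
    · simp only [slrWriteEntry, Prog.ev, ev_emit, Expr.val, outState_reg_succ, outState_mem]
      -- Entry `2 + (c d + t)` of the input was moved to the address `-1 - (2 + (c d + t))`, which
      -- explains the constant `-3` in `slrWriteEntry`.
      rw [splitMem_neg (k := 2 + (c * I.d + t)) _ _ (by simp; ring), I.getD_encode hc ht,
        setReg_outState (by simp)]
      simp
  · simp only [slrWriteColEnd, Prog.ev, ev_emit, Expr.val, outState_reg_succ, OVInstance.slrColCode]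
    have : (0 : ℤ) < [(I.n : ℤ), I.d, L, c, I.d].getD 0 0 - [(I.n : ℤ), I.d, L, c, I.d].getD 3 0 ↔
        c < I.n := by simp
    simp only [this]
    split_ifs <;> simp [ev_emit, setReg_outState, outState_reg_succ, Expr.val]

theorem OVInstance.bit_natAbs_le (I : OVInstance) (c l : ℕ) : ((I.bit c l).toNat : ℤ).natAbs ≤ 1 := by
  cases I.bit c l <;> simp

/-- The entries are at most `24d` or `2n` up to small constants, and the output has `4nd + 12n + 2d
+ 10 ≤ 28nd` numbers; 100 is a generous common factor. -/
theorem OVInstance.fits (I : OVInstance) :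
    Fits (100 * (I.n * I.d)) (fun k => I.encode.getD k 0) I.toSLR.encode := by
  have hn := I.n_pos
  have hd := I.d_pos
  have h1 : I.n ≤ I.n * I.d := Nat.le_mul_of_pos_right _ hd
  have h2 : I.d ≤ I.n * I.d := Nat.le_mul_of_pos_left _ hn
  refine ⟨by omega, natAbs_getD_le fun v hv => ?_, fun v hv => ?_, ?_⟩
  · rw [I.encode_eq] at hv
    simp only [List.mem_append, List.mem_flatMap, List.mem_map, List.mem_cons, List.not_mem_nil,
      or_false] at hv
    rcases hv with (rfl | rfl) | ⟨c, -, l, -, rfl⟩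
    · simp; omega
    · simp; omega
    · have := I.bit_natAbs_le c l
      omega
  · rw [I.encode_toSLR] at hv
    simp only [List.mem_append, List.mem_flatMap, OVInstance.slrHead, OVInstance.slrTargetCode,
      List.mem_cons, List.not_mem_nil, or_false] at hv
    rcases hv with (hv | ⟨-, -, hv⟩ | hv) | ⟨c, -, hv⟩
    · omega
    · omega
    · omega
    · simp only [OVInstance.slrColCode, List.mem_append, List.mem_flatMap, List.mem_cons,
        List.not_mem_nil, or_false] at hv
      rcases hv with ⟨l, -, hv⟩ | hv
      · have := I.bit_natAbs_le c l
        omega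
      · split_ifs at hv <;> simp only [List.mem_cons, List.not_mem_nil, or_false] at hv <;> omega
  · rw [I.encode_toSLR]
    have : ∀ c, (I.slrColCode c).length = I.d * 2 + 6 := fun c => by
      rw [OVInstance.slrColCode, List.length_append, length_flatMap_range (w := 2) (by simp)]
      split_ifs <;> rfl
    rw [List.length_append, List.length_append, length_flatMap_range this, OVInstance.slrTargetCode,
      List.length_append, length_flatMap_range (w := 2) (by simp)]
    simp only [OVInstance.slrHead, List.length_cons, List.length_nil]
    have : (I.n + I.n) * (I.d * 2 + 6) = 4 * (I.n * I.d) + 12 * I.n := by ring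
    omega

/-- The cost is dominated by the `O(nd)` matrix entries, each written at logarithmic cost. `K` is
assembled from the weights of the pieces, so it depends on the program only. -/
theorem runs_ovToSLRProg : ∃ K, ∀ (I : OVInstance) (ω : ℕ → Bool),
    Runs ovToSLRProg (initState I.encode ω) (initState I.toSLR.encode ω)
      (K * (I.n * I.d) * (100 * (I.n * I.d)).size) := by
  refine ⟨ovSetup.wt + 5 * loopWt (.sub (.reg 3) (.reg 4)) moveCell + slrWriteHead.wt +
    2 * loopWt (.sub (.reg 2) (.reg 5)) slrWriteTwo + slrWriteTargetEnd.wt +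
    3 * (2 * loopWt (.sub (.reg 2) (.reg 5)) slrWriteEntry + slrWriteColEnd.wt +
      ((Expr.sub (.add (.reg 1) (.reg 1)) (.reg 4)).wt + 1)) +
    (Prog.assign 4 (.const 0)).wt + 5 * loopWt (.sub (.reg 3) (.reg 4)) clearCell +
    clearSixRegs.wt, fun I ω => ?_⟩
  have hn := I.n_pos
  have hd := I.d_pos
  have h1 : I.n ≤ I.n * I.d := Nat.le_mul_of_pos_right _ hd
  have h2 : I.d ≤ I.n * I.d := Nat.le_mul_of_pos_left _ hn
  have h := I.fits
  have hlen := I.length_encode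
  have henc := I.encode_toSLR
  generalize hF : I.toSLR.encode = F at *
  generalize hM : 100 * (I.n * I.d) = M at *
  obtain ⟨L, hL⟩ : ∃ L, L = 2 + (I.n + I.n) * I.d := ⟨_, rfl⟩
  have hL' : L = 2 + 2 * (I.n * I.d) := by rw [hL]; ring
  set f : ℕ → ℤ := fun k => I.encode.getD k 0 with hf
  have hf0 : ∀ k, L ≤ k → f k = 0 := fun k hk => by
    simp only [hf]
    rw [List.getD_eq_default]
    omega
  have hfn : f 0 = I.n := by simp [hf, I.encode_eq]
  have hfd : f 1 = I.d := by simp [hf, I.encode_eq]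
  have hM1 := h.one_le
  have hp2 : I.slrHead ++ I.slrTargetCode <+: F := by
    rw [henc]
    exact List.prefix_append _ _
  have hp3 : I.slrHead ++ (List.range I.d).flatMap (fun _ => [(2 : ℤ), 1]) <+: F := by
    refine List.IsPrefix.trans ?_ hp2
    rw [OVInstance.slrTargetCode, ← List.append_assoc]
    exact List.prefix_append _ _
  have hl : ∀ c ≤ L, ∀ t ≤ I.d, ∀ v ∈ [(I.n : ℤ), I.d, L, c, t], v.natAbs ≤ M := by
    intro c hc t ht
    simp
    omega
  have r1 : Runs ovSetup (initState I.encode ω)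
      (listState [0, I.n, I.d, L, 0, 0] (splitMem (fun _ => 0) f) ω) (ovSetup.wt * M.size) := by
    rw [initState_eq, ← listState_eq_nil (l := [0, 0, 0, 0, 0, 0]) (by simp)]
    refine Runs.block (by simp [ovSetup, Prog.IsBlock]) hM1
      (Small.listState (by simp) (by simp) h.input ω) ?_
    simp only [ovSetup, Prog.ev, Expr.val, listState_reg, listState_mem, setReg_listState,
      List.length_cons, List.length_nil, List.length_set, Nat.reduceAdd, Nat.reduceLT]
    have e0 : splitMem (fun _ => 0) f 0 = I.n := (splitMem_nonneg _ _ (k := 0) rfl).trans hfn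
    have e1 : splitMem (fun _ => 0) f 1 = I.d := (splitMem_nonneg _ _ (k := 1) rfl).trans hfd
    rw [← hf, e0, e1, hL]
    simp
  have r2 := runs_moveInput (M := M) (L := L) (x := 0) (y := I.n) (z := I.d) (l := [0]) (f := f)
    hM1 (by omega) (by simp; omega) h.input hf0 ω
  have r3 : Runs slrWriteHead (outState [I.n, I.d, L, L, 0] f [] ω)
      (outState [I.n, I.d, L, 0, 0] f I.slrHead ω) (slrWriteHead.wt * M.size) := by
    refine Runs.block (by simp [slrWriteHead, Prog.IsBlock, isBlock_emit]) hM1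
      (h.small List.nil_prefix (hl L le_rfl 0 (by omega)) ω) ?_
    simp [slrWriteHead, Prog.ev, ev_emit, Expr.val, outState_reg_succ, setReg_outState,
      OVInstance.slrHead]
  have r4 : Runs (.loop (.sub (.reg 2) (.reg 5)) slrWriteTwo)
      (outState [I.n, I.d, L, 0, 0] f I.slrHead ω)
      (outState [I.n, I.d, L, 0, I.d] f
        (I.slrHead ++ (List.range I.d).flatMap (fun _ => [(2 : ℤ), 1])) ω)
      ((I.d + 1) * (loopWt (.sub (.reg 2) (.reg 5)) slrWriteTwo * M.size)) := by
    refine Runs.emit_loop_block (by simp [slrWriteTwo, Prog.IsBlock, isBlock_emit]) h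
      (fun t => [(I.n : ℤ), I.d, L, 0, t]) _ I.d (hl 0 (by omega)) hp3 (fun t ht o => ?_)
      (fun o => ?_) (fun t ht o => ?_) (by simp)
    · simp [Expr.val, outState_reg_succ]; omega
    · simp [Expr.val, outState_reg_succ]
    · simp [slrWriteTwo, Prog.ev, ev_emit, Expr.val, outState_reg_succ, setReg_outState]
  have r5 : Runs slrWriteTargetEnd
      (outState [I.n, I.d, L, 0, I.d] f
        (I.slrHead ++ (List.range I.d).flatMap (fun _ => [(2 : ℤ), 1])) ω)
      (outState [I.n, I.d, L, 0, 0] f (I.slrHead ++ I.slrTargetCode) ω)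
      (slrWriteTargetEnd.wt * M.size) := by
    refine Runs.block (by simp [slrWriteTargetEnd, Prog.IsBlock, isBlock_emit]) hM1
      (h.small hp3 (hl 0 (by omega) I.d le_rfl) ω) ?_
    simp [slrWriteTargetEnd, Prog.ev, ev_emit, Expr.val, outState_reg_succ, setReg_outState,
      OVInstance.slrTargetCode]
  have r6 : Runs slrWriteCols (outState [I.n, I.d, L, 0, 0] f (I.slrHead ++ I.slrTargetCode) ω)
      (outState [I.n, I.d, L, (I.n + I.n : ℕ), 0] f F ω)
      ((I.n + I.n + 1) * ((I.d + 1) * (loopWt (.sub (.reg 2) (.reg 5)) slrWriteEntry * M.size) +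
        slrWriteColEnd.wt * M.size +
        ((Expr.sub (.add (.reg 1) (.reg 1)) (.reg 4)).wt + 1) * M.size)) := by
    rw [henc]
    refine Runs.emit_loop h (fun c => [(I.n : ℤ), I.d, L, c, 0]) _ (I.n + I.n)
      (fun c hc => hl c (by omega) 0 (by omega)) (by rw [henc]) (fun c hc o => ?_)
      (fun o => ?_)
      (fun c hc o ho => runs_slrWriteCol I h (by omega) (by omega) (by omega) hc ho ω) (by simp)
    · simp [Expr.val, outState_reg_succ]; omega
    · simp [Expr.val, outState_reg_succ]
  have r7 : Runs (.assign 4 (.const 0)) (outState [I.n, I.d, L, (I.n + I.n : ℕ), 0] f F ω)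
      (outState [I.n, I.d, L, 0, 0] f F ω) ((Prog.assign 4 (.const 0)).wt * M.size) := by
    refine Runs.block (by simp [Prog.IsBlock]) hM1
      (h.small List.prefix_rfl (hl (I.n + I.n) (by omega) 0 (by omega)) ω) ?_
    simp [Prog.ev, Expr.val, setReg_outState]
  have r8 := runs_clearInput (M := M) (L := L) (x := F.length) (y := I.n) (z := I.d) (l := [0])
    (f := f) (g := fun k => F.getD k 0) hM1 (by omega)
    (by have := h.length; simp; omega) h.input (natAbs_getD_le h.output) hf0 ω
  have r9 : Runs clearSixRegs
      (listState [F.length, I.n, I.d, L, L, 0] (splitMem (fun _ => 0) fun k => F.getD k 0) ω)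
      (initState F ω) (clearSixRegs.wt * M.size) := by
    refine Runs.block (by simp [clearSixRegs, Prog.IsBlock]) hM1
      (Small.listState (by have := h.length; simp; omega) (by simp)
        (natAbs_getD_le h.output) ω) ?_
    rw [initState_eq, ← listState_eq_nil (l := [0, 0, 0, 0, 0, 0]) (by simp)]
    simp [clearSixRegs, Prog.ev, Expr.val, setReg_listState]
  refine (r1.seq (r2.seq (r3.seq (r4.seq (r5.seq (r6.seq (r7.seq (r8.seq r9)))))))).mono ?_
  -- The numbers of loop tests are compared with `nd`, using `n, d ≥ 1`; the factors 5, 2, 6 and 3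
  -- are those that enter `K`.
  have q1 : L + 1 ≤ 5 * (I.n * I.d) := by omega
  have q2 : I.d + 1 ≤ 2 * (I.n * I.d) := by omega
  have q3 : (I.n + I.n + 1) * (I.d + 1) ≤ 6 * (I.n * I.d) := by nlinarith
  have q4 : I.n + I.n + 1 ≤ 3 * (I.n * I.d) := by omega
  have q5 : 1 ≤ I.n * I.d := by omega
  generalize I.n * I.d = X at q1 q2 q3 q4 q5 ⊢
  generalize M.size = S
  generalize ovSetup.wt = a1, loopWt (.sub (.reg 3) (.reg 4)) moveCell = a2, slrWriteHead.wt = a3,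
    loopWt (.sub (.reg 2) (.reg 5)) slrWriteTwo = a4, slrWriteTargetEnd.wt = a5,
    loopWt (.sub (.reg 2) (.reg 5)) slrWriteEntry = a6, slrWriteColEnd.wt = a7,
    (Expr.sub (.add (.reg 1) (.reg 1)) (.reg 4)).wt = a8, (Prog.assign 4 (.const 0)).wt = a9,
    loopWt (.sub (.reg 3) (.reg 4)) clearCell = a10, clearSixRegs.wt = a11
  have := Nat.mul_le_mul_right (a2 * S) q1
  have := Nat.mul_le_mul_right (a4 * S) q2
  have := Nat.mul_le_mul_right (a6 * S) q3
  have := Nat.mul_le_mul_right (a7 * S + (a8 + 1) * S) q4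
  have := Nat.mul_le_mul_right (a1 * S + a3 * S + a5 * S + a9 * S + a11 * S) q5
  have := Nat.mul_le_mul_right (a10 * S) q1
  linarith

/-! ### Running time of the reduction from orthogonal vectors -/

/-- The crude estimate of a bit length by the absolute value is enough, because the entries are
linear in `d` and any polynomial in `d` is allowed. -/
theorem ratBits_intCast_le {z : ℤ} {B : ℕ} (hB : 1 ≤ B) (hz : z.natAbs ≤ B) :
    ratBits (z : ℚ) ≤ B := by
  have h : bitLen z ≤ B := bitLen_le_iff.2 (hz.trans_lt Nat.lt_two_pow_self)
  have h1 : bitLen 1 ≤ B := bitLen_le_iff.2 (Nat.one_lt_two_pow (by omega))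
  simpa [ratBits] using ⟨h, h1⟩

theorem OVInstance.bits_toSLR_le (I : OVInstance) : I.toSLR.bits ≤ 24 * I.d := by
  have hd := I.d_pos
  refine max_le ?_ (max_le (Finset.sup_le fun i _ => ?_)
    (Finset.sup_le fun i _ => Finset.sup_le fun j _ => ?_))
  · have : I.toSLR.δ = ((I.d + 1 : ℤ) : ℚ) := by simp [OVInstance.toSLR]
    rw [this]
    exact ratBits_intCast_le (by omega) (by omega)
  · refine ratBits_intCast_le (by omega) ?_
    rw [OVInstance.slrTarget]
    split_ifs <;> omega
  · refine ratBits_intCast_le (by omega) ?_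
    have := I.bit_natAbs_le j i
    rw [OVInstance.slrEntry]
    split_ifs <;> omega

/-- Bounds the logarithmic cost factor by `2√m`, so that the reduction takes time `O(n^(3/2) d^2)`.
-/
theorem size_sq_le {m : ℕ} (hm : 1 ≤ m) : m.size ^ 2 ≤ 4 * m := by
  have h1 : 1 ≤ m.size := Nat.size_pos.2 hm
  obtain ⟨s, hs⟩ : ∃ s, m.size = s + 1 := ⟨m.size - 1, by omega⟩
  have h2 : 2 ^ s ≤ m := Nat.lt_size.1 (by omega)
  have h3 : ∀ s : ℕ, (s + 1) ^ 2 ≤ 4 * 2 ^ s := by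
    intro s
    induction s with
    | zero => norm_num
    | succ s ih =>
      -- The induction needs `(s+2)^2 ≤ 2(s+1)^2`, which fails for `s = 0` and `s = 1`.
      rcases Nat.lt_or_ge s 2 with h | h
      · interval_cases s <;> norm_num
      · rw [pow_succ 2 s]
        nlinarith
  rw [hs]
  have := h3 s
  omega

/-- Sparse regression in time `n ^ (2 - ε) * poly(d)` gives Orthogonal Vectors in such time. -/
theorem ov_solvable_of_slr {ε C : ℝ} {c : ℕ} (hε : 0 < ε)
    (h : (SLR 2).SolvableInTime fun I : SLRInstance =>
      C * (I.n : ℝ) ^ (2 - ε) * ((I.d : ℝ) * (I.bits : ℝ)) ^ c) :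
    ∃ ε' : ℝ, 0 < ε' ∧ ε' ≤ 1 ∧ ∃ (C' : ℝ) (c' : ℕ), 0 ≤ C' ∧
      OV.SolvableInTime fun I : OVInstance => C' * (I.n : ℝ) ^ (2 - ε') * (I.d : ℝ) ^ c' := by
  obtain ⟨K, hK⟩ := runs_ovToSLRProg
  -- The cap `1/2` makes room for the `n^(3/2)` of the reduction itself. In the constants `96 = 4 ·
  -- 24` comes from `d + 3 ≤ 4d` and the bit length `24d`; the exponent `2c + 2` covers both
  -- `d^(2c)` and the `d^2` of the reduction.
  refine ⟨min ε (1 / 2), by positivity, (min_le_right _ _).trans (by norm_num),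
    20 * K + 4 * |C| * 96 ^ c, 2 * c + 2, by positivity, ?_⟩
  refine (h.of_reduction (P := OV) OVInstance.toSLR OVInstance.toSLR_isYes_iff ovToSLRProg _
    hK).mono fun I => ?_
  change OVInstance at I
  set ε' := min ε (1 / 2)
  have hε' : ε' ≤ ε := min_le_left _ _
  have hε'' : ε' ≤ 1 / 2 := min_le_right _ _
  have hε0 : 0 < ε' := by positivity
  have hn : (1 : ℝ) ≤ I.n := by exact_mod_cast I.n_pos
  have hd : (1 : ℝ) ≤ I.d := by exact_mod_cast I.d_pos
  have hpow : (I.n : ℝ) * √I.n ≤ (I.n : ℝ) ^ (2 - ε') := by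
    calc (I.n : ℝ) * √I.n = (I.n : ℝ) ^ ((1 : ℝ) + 1 / 2) := by
          rw [Real.rpow_add (by linarith), Real.rpow_one, Real.sqrt_eq_rpow]
      _ ≤ _ := Real.rpow_le_rpow_of_exponent_le hn (by linarith)
  have hsize : ((100 * (I.n * I.d)).size : ℝ) ≤ 20 * (√I.n * I.d) := by
    have h1 : ((100 * (I.n * I.d)).size : ℝ) ^ 2 ≤ 400 * (I.n * I.d) := by
      have := size_sq_le (m := 100 * (I.n * I.d))
        (Nat.mul_pos (by norm_num) (Nat.mul_pos I.n_pos I.d_pos))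
      have h' : (((100 * (I.n * I.d)).size ^ 2 : ℕ) : ℝ) ≤ ((4 * (100 * (I.n * I.d)) : ℕ) : ℝ) :=
        Nat.cast_le.2 this
      push_cast at h'
      linarith
    refine abs_le_of_sq_le_sq' ?_ (by positivity) |>.2
    rw [mul_pow, mul_pow, Real.sq_sqrt (by linarith)]
    nlinarith [mul_le_mul_of_nonneg_left hd (show 0 ≤ (I.n : ℝ) * I.d by positivity)]
  have hR : ((K * (I.n * I.d) * (100 * (I.n * I.d)).size : ℕ) : ℝ) ≤
      20 * K * (I.n : ℝ) ^ (2 - ε') * (I.d : ℝ) ^ (2 * c + 2) := by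
    push_cast
    calc (K : ℝ) * (I.n * I.d) * (100 * (I.n * I.d)).size
        ≤ K * (I.n * I.d) * (20 * (√I.n * I.d)) := by gcongr
      _ = 20 * K * (I.n * √I.n) * (I.d : ℝ) ^ 2 := by ring
      _ ≤ 20 * K * (I.n : ℝ) ^ (2 - ε') * (I.d : ℝ) ^ (2 * c + 2) := by
        gcongr
        omega
  -- The number of columns is `2n ≥ 1`, so lowering `ε` to `ε'` only increases the power, and
  -- doubling costs a factor of at most `2^2`.
  have hA : ((I.toSLR.n : ℕ) : ℝ) ^ (2 - ε) ≤ 4 * (I.n : ℝ) ^ (2 - ε') := by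
    have : ((I.toSLR.n : ℕ) : ℝ) = 2 * I.n := by simp [OVInstance.toSLR]; ring
    rw [this]
    calc (2 * (I.n : ℝ)) ^ (2 - ε) ≤ (2 * (I.n : ℝ)) ^ (2 - ε') :=
          Real.rpow_le_rpow_of_exponent_le (by linarith) (by linarith)
      _ = 2 ^ (2 - ε') * (I.n : ℝ) ^ (2 - ε') := Real.mul_rpow (by norm_num) (by linarith)
      _ ≤ 2 ^ (2 : ℝ) * (I.n : ℝ) ^ (2 - ε') := by
        gcongr
        · norm_num
        · linarith
      _ = 4 * (I.n : ℝ) ^ (2 - ε') := by norm_num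
  have hB : ((I.toSLR.d : ℝ) * (I.toSLR.bits : ℝ)) ^ c ≤ 96 ^ c * (I.d : ℝ) ^ (2 * c + 2) := by
    have h1 : (I.toSLR.bits : ℝ) ≤ 24 * I.d := by exact_mod_cast I.bits_toSLR_le
    have h2 : (I.toSLR.d : ℝ) ≤ 4 * I.d := by
      have : (I.toSLR.d : ℝ) = I.d + 3 := by simp [OVInstance.toSLR]
      linarith
    calc ((I.toSLR.d : ℝ) * (I.toSLR.bits : ℝ)) ^ c ≤ (4 * I.d * (24 * I.d)) ^ c := by gcongr
      _ = 96 ^ c * (I.d : ℝ) ^ (2 * c) := by rw [pow_mul, ← mul_pow]; ring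
      _ ≤ _ := by
        gcongr
        omega
  have hT : C * (I.toSLR.n : ℝ) ^ (2 - ε) * ((I.toSLR.d : ℝ) * (I.toSLR.bits : ℝ)) ^ c ≤
      |C| * (4 * (I.n : ℝ) ^ (2 - ε')) * (96 ^ c * (I.d : ℝ) ^ (2 * c + 2)) := by
    gcongr
    -- The given constant may be negative.
    exact le_abs_self C
  refine (add_le_add hR hT).trans (le_of_eq ?_)
  ring

/-! ### From satisfiability to orthogonal vectors -/

/-- Whether the assignment that is given by the bits of `a` to the variables of parity `side` does
not satisfy the clause `c`. -/
def unsatBy {n : ℕ} (side a : ℕ) (c : List (Fin n × Bool)) : Bool :=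
  c.all fun l => !(decide ((l.1 : ℕ) % 2 = side) && a.testBit (l.1 / 2) == l.2)

/-- The instance of Orthogonal Vectors for a formula. The vectors of `U` are given by assignments of
the variables of even number, those of `V` by assignments of the variables of odd number. -/
def KCNF.toOV {k : ℕ} (φ : KCNF k) : OVInstance where
  n := 2 ^ ((φ.n + 1) / 2)
  d := φ.clauses.length + 1
  n_pos := by positivity
  d_pos := by omega
  U := fun a j => (φ.clauses[(j : ℕ)]?.map (unsatBy 0 a)).getD false
  V := fun a j => (φ.clauses[(j : ℕ)]?.map (unsatBy 1 a)).getD false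

theorem unsatBy_eq_false_iff {n : ℕ} (side a : ℕ) (c : List (Fin n × Bool)) :
    unsatBy side a c = false ↔ ∃ l ∈ c, (l.1 : ℕ) % 2 = side ∧ a.testBit (l.1 / 2) = l.2 := by
  simp [unsatBy]

/-- The product at coordinate `j` vanishes iff one of the two half assignments satisfies clause `j`.
Bits of the numbers `a`, `b` and assignments of the halves translate into each other by
`Nat.testBit` and `Nat.ofBits`. -/
theorem KCNF.toOV_isYes_iff {k : ℕ} (φ : KCNF k) : φ.toOV.IsYes ↔ φ.Satisfiable := by
  have key : φ.toOV.IsYes ↔ ∃ a < 2 ^ ((φ.n + 1) / 2), ∃ b < 2 ^ ((φ.n + 1) / 2),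
      ∀ c ∈ φ.clauses, unsatBy 0 a c = false ∨ unsatBy 1 b c = false := by
    constructor
    · rintro ⟨a, b, h⟩
      refine ⟨a, a.2, b, b.2, fun c hc => ?_⟩
      obtain ⟨j, hj, rfl⟩ := List.getElem_of_mem hc
      have := (Finset.sum_eq_zero_iff.1 h) ⟨j, Nat.lt_succ_of_lt hj⟩ (Finset.mem_univ _)
      simpa [KCNF.toOV, hj] using this
    · rintro ⟨a, ha, b, hb, h⟩
      refine ⟨⟨a, ha⟩, ⟨b, hb⟩, Finset.sum_eq_zero fun j _ => ?_⟩
      rcases lt_or_ge (j : ℕ) φ.clauses.length with hj | hj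
      · simpa [KCNF.toOV, hj] using h _ (List.getElem_mem hj)
      -- The coordinate past the last clause, which keeps the dimension positive, is `false` by
      -- default.
      · simp [KCNF.toOV, hj]
  rw [key]
  constructor
  · rintro ⟨a, -, b, -, h⟩
    refine ⟨fun i => if (i : ℕ) % 2 = 0 then a.testBit (i / 2) else b.testBit (i / 2),
      fun c hc => ?_⟩
    rcases h c hc with h | h
    · obtain ⟨l, hl, h1, h2⟩ := (unsatBy_eq_false_iff _ _ _).1 h
      exact ⟨l, hl, by simp [h1, h2]⟩
    · obtain ⟨l, hl, h1, h2⟩ := (unsatBy_eq_false_iff _ _ _).1 h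
      exact ⟨l, hl, by simp [h1, h2]⟩
  · rintro ⟨α, h⟩
    -- For odd `n` the odd half has one bit too many, at the index `n`; it is set to `false`.
    let β : ℕ → Bool := fun i => if hi : i < φ.n then α ⟨i, hi⟩ else false
    have hβ : ∀ (s : ℕ) (i : Fin φ.n), (i : ℕ) % 2 = s →
        (Nat.ofBits fun t : Fin ((φ.n + 1) / 2) => β (2 * t + s)).testBit (i / 2) = α i := by
      intro s i hi
      have hlt : (i : ℕ) / 2 < (φ.n + 1) / 2 := by omega
      rw [Nat.testBit_ofBits_lt _ _ hlt]
      have : 2 * ((i : ℕ) / 2) + s = i := by omega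
      simp [β, this]
    refine ⟨_, Nat.ofBits_lt_two_pow fun t : Fin ((φ.n + 1) / 2) => β (2 * t + 0), _,
      Nat.ofBits_lt_two_pow fun t : Fin ((φ.n + 1) / 2) => β (2 * t + 1), fun c hc => ?_⟩
    obtain ⟨l, hl, hs⟩ := h c hc
    rcases Nat.mod_two_eq_zero_or_one l.1 with h0 | h1
    · exact Or.inl ((unsatBy_eq_false_iff _ _ _).2 ⟨l, hl, h0, (hβ 0 l.1 h0).trans hs⟩)
    · exact Or.inr ((unsatBy_eq_false_iff _ _ _).2 ⟨l, hl, h1, (hβ 1 l.1 h1).trans hs⟩)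

/-- A clause of size at most `k` is determined by its first `k` entries, with `none` past its end,
so distinct clauses inject into `k`-tuples over `2n + 1` symbols. -/
theorem KCNF.length_clauses_le {k : ℕ} (φ : KCNF k) :
    φ.clauses.length ≤ (2 * φ.n + 1) ^ k := by
  classical
  have h1 : φ.clauses.length = φ.clauses.toFinset.card :=
    (List.toFinset_card_of_nodup φ.nodup).symm
  have h2 : Fintype.card (Fin k → Option (Fin φ.n × Bool)) = (2 * φ.n + 1) ^ k := by
    simp [mul_comm]
  rw [h1, ← h2, ← Finset.card_univ]
  refine Finset.card_le_card_of_injOn (fun cl i => cl[(i : ℕ)]?) (by simp) ?_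
  intro c hc c' hc' h
  have hc := φ.size_le c (by simpa using hc)
  have hc' := φ.size_le c' (by simpa using hc')
  apply List.ext_getElem?
  intro i
  rcases lt_or_ge i k with hi | hi
  · exact congrFun h ⟨i, hi⟩
  · rw [List.getElem?_eq_none (by omega), List.getElem?_eq_none (by omega)]

section

/-! ### Reading the encoding of a formula -/

/-- The code of a clause. -/
def encodeClause {n : ℕ} (c : List (Fin n × Bool)) : List ℤ := (c.length : ℤ) :: c.map encodeLit

theorem length_encodeClause {n : ℕ} (c : List (Fin n × Bool)) :
    (encodeClause c).length = c.length + 1 := by simp [encodeClause]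

variable {k : ℕ} (φ : KCNF k)

/-- The input, as a function of the address. -/
def KCNF.input (a : ℕ) : ℤ := φ.encode.getD a 0

/-- The position of the `j`-th clause in the input. -/
def KCNF.pos (j : ℕ) : ℕ := 2 + ((φ.clauses.take j).map encodeClause).flatten.length

theorem KCNF.encode_eq : φ.encode =
    [(φ.n : ℤ), (φ.clauses.length : ℤ)] ++ (φ.clauses.map encodeClause).flatten := rfl

theorem KCNF.pos_zero : φ.pos 0 = 2 := by simp [KCNF.pos]

theorem KCNF.pos_length : φ.pos φ.clauses.length = φ.encode.length := by
  rw [KCNF.pos, List.take_length, KCNF.encode_eq, List.length_append]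
  rfl

theorem KCNF.pos_succ {j : ℕ} (hj : j < φ.clauses.length) :
    φ.pos (j + 1) = φ.pos j + 1 + φ.clauses[j].length := by
  rw [KCNF.pos, List.take_add_one, List.getElem?_eq_getElem hj]
  simp only [Option.toList_some, List.map_append, List.flatten_append, List.length_append,
    List.map_cons, List.map_nil, List.flatten_cons, List.flatten_nil, List.length_nil,
    length_encodeClause, KCNF.pos]
  omega

theorem KCNF.pos_le (j : ℕ) : φ.pos j ≤ φ.encode.length := by
  have := congrArg (fun l => (l.map encodeClause).flatten.length)
    (List.take_append_drop j φ.clauses)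
  simp only [List.map_append, List.flatten_append, List.length_append] at this
  rw [← KCNF.pos_length, KCNF.pos, KCNF.pos, List.take_length]
  omega

theorem KCNF.input_pos_add {j : ℕ} (hj : j < φ.clauses.length) {t : ℕ}
    (ht : t ≤ φ.clauses[j].length) :
    φ.input (φ.pos j + t) = (encodeClause φ.clauses[j]).getD t 0 := by
  have h : φ.encode = ([(φ.n : ℤ), (φ.clauses.length : ℤ)] ++
      ((φ.clauses.take j).map encodeClause).flatten) ++ (encodeClause φ.clauses[j] ++
        ((φ.clauses.drop (j + 1)).map encodeClause).flatten) := by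
    have h' := congrArg (fun l => (l.map encodeClause).flatten)
      (List.take_append_drop j φ.clauses)
    simp only [List.drop_eq_getElem_cons hj, List.map_append, List.flatten_append, List.map_cons,
      List.flatten_cons] at h'
    rw [KCNF.encode_eq, ← h', List.append_assoc]
  have hlen : ([(φ.n : ℤ), (φ.clauses.length : ℤ)] ++
      ((φ.clauses.take j).map encodeClause).flatten).length = φ.pos j := by
    rw [List.length_append, KCNF.pos]
    rfl
  rw [KCNF.input, h, List.getD_append_right _ _ _ _ (by omega), hlen, Nat.add_sub_cancel_left,
    List.getD_append]
  rw [length_encodeClause]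
  omega

theorem KCNF.input_pos {j : ℕ} (hj : j < φ.clauses.length) :
    φ.input (φ.pos j) = φ.clauses[j].length := by
  simpa [encodeClause] using φ.input_pos_add hj (Nat.zero_le _)

theorem KCNF.input_lit {j : ℕ} (hj : j < φ.clauses.length) {t : ℕ}
    (ht : t < φ.clauses[j].length) :
    φ.input (φ.pos j + 1 + t) = encodeLit φ.clauses[j][t] := by
  have := φ.input_pos_add hj (t := 1 + t) (by omega)
  rw [← add_assoc] at this
  rw [this, add_comm 1 t]
  simp [encodeClause, ht]

theorem KCNF.length_encode_le : φ.encode.length ≤ 2 + φ.clauses.length * (k + 1) := by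
  rw [KCNF.encode_eq, List.length_append, List.length_flatten]
  simp only [List.map_map, List.length_cons, List.length_nil, zero_add, Nat.reduceAdd]
  gcongr
  have := List.sum_le_card_nsmul (φ.clauses.map (List.length ∘ encodeClause)) (k + 1) (by
    simp only [List.mem_map, Function.comp_apply, length_encodeClause]
    rintro _ ⟨c, hc, rfl⟩
    have := φ.size_le c hc
    omega)
  simpa using this

theorem natAbs_encodeLit_le {n : ℕ} (l : Fin n × Bool) : (encodeLit l).natAbs ≤ n := by
  have := l.1.2
  rw [encodeLit]
  split_ifs <;> omega

theorem KCNF.natAbs_input_le (a : ℕ) :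
    (φ.input a).natAbs ≤ max φ.n (max φ.clauses.length k) := by
  refine natAbs_getD_le (fun v hv => ?_) a
  rw [KCNF.encode_eq] at hv
  simp only [List.mem_append, List.mem_cons, List.not_mem_nil, or_false, List.mem_flatten,
    List.mem_map] at hv
  rcases hv with (rfl | rfl) | ⟨-, ⟨c, hc, rfl⟩, hv⟩
  · simp
  · simp
  · rcases List.mem_cons.1 hv with rfl | hv
    · have := φ.size_le c hc
      simp [this]
    · obtain ⟨l, -, rfl⟩ := List.mem_map.1 hv
      exact (natAbs_encodeLit_le l).trans (le_max_left _ _)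

/-! ### The program -/

/-- Half the number of variables, rounded up. -/
def KCNF.half : ℕ := (φ.n + 1) / 2

/-- The registers from register 1 on. -/
def KCNF.regs (A side a : ℕ) (j q fl len c x τ : ℤ) : List ℤ :=
  [φ.n, φ.clauses.length, φ.encode.length, A, (2 ^ φ.half : ℕ), side, a, j, q, fl, len, c, x, τ]

/-- The number `M` bounds all the numbers that occur. -/
structure KCNF.Ctx (M : ℕ) (F : List ℤ) : Prop where
  fits : Fits M φ.input F
  n_le : φ.n + 2 ≤ M
  m_le : φ.clauses.length ≤ M
  len_le : φ.encode.length ≤ M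
  pow_le : 2 ^ φ.half + 2 ^ φ.half ≤ M
  k_le : k ≤ M

variable {φ}

theorem KCNF.Ctx.small {M : ℕ} {F o : List ℤ} (h : φ.Ctx M F) (ho : o <+: F) {A side a : ℕ}
    {j q fl len c x τ : ℤ} (hA : A ≤ M) (hside : side ≤ M) (ha : a ≤ M)
    (hl : ∀ v ∈ [j, q, fl, len, c, x, τ], v.natAbs ≤ M) (ω : ℕ → Bool) :
    Small M (outState (φ.regs A side a j q fl len c x τ) φ.input o ω) := by
  refine h.fits.small ho ?_ ω
  have hn := h.n_le
  have hm := h.m_le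
  have hlen := h.len_le
  have hpow := h.pow_le
  simp only [List.mem_cons, List.not_mem_nil, or_false, forall_eq_or_imp, forall_eq] at hl
  simp only [KCNF.regs, List.mem_cons, List.not_mem_nil, or_false, forall_eq_or_imp, forall_eq]
  generalize 2 ^ φ.half = P at hpow ⊢
  omega

/-- Halves register 13 and takes 2 off register 12. -/
def satHalve : Prog :=
  .seq (.assign 12 (.sub (.reg 12) (.const 2))) (.assign 13 (.div (.reg 13) (.const 2)))

/-- Finds the bit of an assignment that a literal reads. -/
def satFindBit : Prog := .loop (.sub (.reg 12) (.const 1)) satHalve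

/-- Taking 2 off the variable number while halving `a` takes `i / 2` rounds. It ends with the parity
of `i`, which names the side, and with `a` shifted so that its lowest bit is the value of variable
`i`. -/
theorem runs_satFindBit {M : ℕ} {F o : List ℤ} (h : φ.Ctx M F) (ho : o <+: F) {A side a i : ℕ}
    {j q fl len τ : ℤ} (hA : A ≤ M) (hside : side ≤ M) (ha : a ≤ M) (hi : i < φ.n)
    (hl : ∀ v ∈ [j, q, fl, len, τ], v.natAbs ≤ M) (ω : ℕ → Bool) :
    Runs satFindBit (outState (φ.regs A side a j q fl len i a τ) φ.input o ω)
      (outState (φ.regs A side a j q fl len (i % 2 : ℕ) (a / 2 ^ (i / 2) : ℕ) τ) φ.input o ω)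
      ((φ.n + 1) * (loopWt (.sub (.reg 12) (.const 1)) satHalve * M.size)) := by
  simp only [List.mem_cons, List.not_mem_nil, or_false, forall_eq_or_imp, forall_eq] at hl
  have hn := h.n_le
  refine (Runs.loop_block (M := M) (by simp [satHalve, Prog.IsBlock]) h.fits.one_le
    (fun s => outState (φ.regs A side a j q fl len ((i : ℤ) - 2 * s) (a / 2 ^ s : ℕ) τ)
      φ.input o ω) (i / 2) (fun s hs => ?_) ?_ (fun s hs => ?_) (fun s hs => ?_) (by simp) ?_).mono
      ?_
  · simp [Expr.val, outState_reg_succ, KCNF.regs]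
    omega
  · simp [Expr.val, outState_reg_succ, KCNF.regs]
    omega
  · have := Nat.div_le_self a (2 ^ s)
    refine h.small ho hA hside ha ?_ ω
    generalize a / 2 ^ s = y at this ⊢
    simp only [List.mem_cons, List.not_mem_nil, or_false, forall_eq_or_imp, forall_eq]
    omega
  · simp [satHalve, Prog.ev, Expr.val, outState_reg_succ, setReg_outState, KCNF.regs]
    congr 2
    simp only [List.cons.injEq, true_and, and_true]
    refine ⟨by ring, ?_⟩
    rw [pow_succ]
    have := Nat.div_div_eq_div_mul a (2 ^ s) 2
    exact_mod_cast this
  · congr 3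
    omega
  · gcongr
    omega

/-- Decodes a literal. -/
def satReadLit : Prog :=
  .seq (.ite (.load (.sub (.const (-1)) (.reg 9)))
      (.seq (.assign 12 (.sub (.load (.sub (.const (-1)) (.reg 9))) (.const 1)))
        (.assign 14 (.const 1)))
      (.seq (.assign 12 (.sub (.const (-1)) (.load (.sub (.const (-1)) (.reg 9)))))
        (.assign 14 (.const 0))))
    (.assign 13 (.reg 7))

/-- The value `1 - (e - f) ^ 2`, which for two bits says whether they are equal. -/
def Expr.eqTest (e f : Expr) : Expr := .sub (.const 1) (.mul (.sub e f) (.sub e f))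

/-- Updates the flag that says that no literal has been satisfied. -/
def satUseLit : Prog :=
  .seq (.assign 10 (.mul (.reg 10) (.sub (.const 1) (.mul (.eqTest (.reg 12) (.reg 6))
      (.eqTest (.reg 14) (.sub (.reg 13) (.mul (.const 2) (.div (.reg 13) (.const 2)))))))))
    (.seq (.assign 12 (.const 0)) (.seq (.assign 13 (.const 0)) (.seq (.assign 14 (.const 0))
      (.seq (.assign 9 (.add (.reg 9) (.const 1))) (.assign 11 (.sub (.reg 11) (.const 1)))))))

/-- Handles a literal. -/
def satLit : Prog := .seq satReadLit (.seq satFindBit satUseLit)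

theorem unsatBy_take_succ {n : ℕ} (side a : ℕ) (cl : List (Fin n × Bool)) {t : ℕ}
    (ht : t < cl.length) : unsatBy side a (cl.take (t + 1)) = (unsatBy side a (cl.take t) &&
      !(decide ((cl[t].1 : ℕ) % 2 = side) && a.testBit (cl[t].1 / 2) == cl[t].2)) := by
  rw [unsatBy, List.take_add_one, List.getElem?_eq_getElem ht]
  simp only [List.all_append, Option.toList_some, List.all_cons, List.all_nil, Bool.and_true]
  rfl

/-- On bits, `1 - (e - f)^2` is the indicator of equality and products are conjunctions; `y - 2 (y /
2)` is the lowest bit of the shifted assignment. -/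
theorem satUseLit_flag (u : Bool) {side a i : ℕ} (hside : side < 2) (s : Bool) :
    (u.toNat : ℤ) * (1 - (1 - (((i % 2 : ℕ) : ℤ) - side) * (((i % 2 : ℕ) : ℤ) - side)) *
      (1 - ((s.toNat : ℤ) - (((a / 2 ^ (i / 2) : ℕ) : ℤ) - 2 * (((a / 2 ^ (i / 2) : ℕ) : ℤ) / 2))) *
        ((s.toNat : ℤ) - (((a / 2 ^ (i / 2) : ℕ) : ℤ) - 2 * (((a / 2 ^ (i / 2) : ℕ) : ℤ) / 2))))) =
    ((u && !(decide (i % 2 = side) && a.testBit (i / 2) == s)).toNat : ℤ) := by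
  rw [Nat.testBit_eq_decide_div_mod_eq]
  generalize a / 2 ^ (i / 2) = y
  have h1 : ((y : ℤ) - 2 * ((y : ℤ) / 2)) = ((y % 2 : ℕ) : ℤ) := by omega
  rw [h1]
  rcases Nat.mod_two_eq_zero_or_one i with hi | hi <;>
    rcases Nat.mod_two_eq_zero_or_one y with hy | hy <;>
    interval_cases side <;> cases u <;> cases s <;> simp [hi, hy]

/-- The invariant is that the flag tells whether the first `t` literals are all unsatisfied. The
scratch registers return to 0, so that consecutive literals chain. -/
theorem runs_satLit {M : ℕ} {F o : List ℤ} (h : φ.Ctx M F) (ho : o <+: F) {A side a j t : ℕ}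
    {r : ℤ} (hA : A ≤ M) (hside : side < 2) (ha : a ≤ M) (hr : r.natAbs ≤ M)
    (hj : j < φ.clauses.length) (ht : t < φ.clauses[j].length) (ω : ℕ → Bool) :
    Runs satLit
      (outState (φ.regs A side a r (φ.pos j + 1 + t : ℕ)
        (unsatBy side a (φ.clauses[j].take t)).toNat ((φ.clauses[j].length : ℤ) - t) 0 0 0)
        φ.input o ω)
      (outState (φ.regs A side a r (φ.pos j + 1 + (t + 1) : ℕ)
        (unsatBy side a (φ.clauses[j].take (t + 1))).toNat
        ((φ.clauses[j].length : ℤ) - (t + 1 : ℕ)) 0 0 0) φ.input o ω)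
      ((φ.n + 1) * ((satReadLit.wt + loopWt (.sub (.reg 12) (.const 1)) satHalve + satUseLit.wt) *
        M.size)) := by
  have hn := h.n_le
  have hq : φ.pos j + 1 + (t + 1) ≤ M := by
    have := φ.pos_succ hj
    have := φ.pos_le (j + 1)
    have := h.len_le
    omega
  have hlen : φ.clauses[j].length ≤ M := (φ.size_le _ (List.getElem_mem hj)).trans h.k_le
  have hfl : ((unsatBy side a (φ.clauses[j].take t)).toNat : ℤ).natAbs ≤ M := by
    have := Bool.toNat_le (unsatBy side a (φ.clauses[j].take t))
    omega
  have hin := φ.input_lit hj ht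
  have hflag := unsatBy_take_succ side a φ.clauses[j] ht
  generalize hl : φ.clauses[j][t] = l at hin hflag
  obtain ⟨i, s⟩ := l
  have hτ : (s.toNat : ℤ).natAbs ≤ M := by
    have := Bool.toNat_le s
    omega
  have hi := i.2
  have r1 : Runs satReadLit
      (outState (φ.regs A side a r (φ.pos j + 1 + t : ℕ)
        (unsatBy side a (φ.clauses[j].take t)).toNat ((φ.clauses[j].length : ℤ) - t) 0 0 0)
        φ.input o ω)
      (outState (φ.regs A side a r (φ.pos j + 1 + t : ℕ)
        (unsatBy side a (φ.clauses[j].take t)).toNat ((φ.clauses[j].length : ℤ) - t)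
        ((i : ℕ) : ℤ) a s.toNat) φ.input o ω) (satReadLit.wt * M.size) := by
    refine Runs.block (by simp [satReadLit, Prog.IsBlock]) h.fits.one_le
      (h.small ho hA (by omega) ha ?_ ω) ?_
    · simp only [List.mem_cons, List.not_mem_nil, or_false, forall_eq_or_imp, forall_eq]
      omega
    -- The loaded value depends on register 9 only, so it is the same before and after the
    -- assignments to registers 12 and 14.
    · have hload : ∀ c x τ fl len, (Expr.load (.sub (.const (-1)) (.reg 9))).val
          (outState (φ.regs A side a r (φ.pos j + 1 + t : ℕ) fl len c x τ) φ.input o ω) =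
            encodeLit (i, s) := by
        intro c x τ fl len
        rw [← hin]
        simp only [Expr.val, outState_mem]
        exact splitMem_neg (a := -1 - ((φ.pos j + 1 + t : ℕ) : ℤ)) _ _ rfl
      simp only [satReadLit, Prog.ev, hload]
      cases s
      · rw [if_neg (by simp [encodeLit])]
        simp only [Expr.val.eq_5, hload]
        simp [encodeLit, Expr.val, KCNF.regs, setReg_outState, outState_reg_succ]
      · rw [if_pos (by simp [encodeLit])]
        simp only [Expr.val.eq_5, hload]
        simp [encodeLit, Expr.val, KCNF.regs, setReg_outState, outState_reg_succ]
  have r2 := runs_satFindBit h ho (A := A) (side := side) (a := a) (i := i)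
    (j := r) (q := (φ.pos j + 1 + t : ℕ)) (fl := (unsatBy side a (φ.clauses[j].take t)).toNat)
    (len := (φ.clauses[j].length : ℤ) - t) (τ := s.toNat) hA (by omega) ha hi (by
      simp only [List.mem_cons, List.not_mem_nil, or_false, forall_eq_or_imp, forall_eq]
      omega) ω
  have r3 : Runs satUseLit
      (outState (φ.regs A side a r (φ.pos j + 1 + t : ℕ)
        (unsatBy side a (φ.clauses[j].take t)).toNat ((φ.clauses[j].length : ℤ) - t)
        ((i : ℕ) % 2 : ℕ) (a / 2 ^ ((i : ℕ) / 2) : ℕ) s.toNat) φ.input o ω)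
      (outState (φ.regs A side a r (φ.pos j + 1 + (t + 1) : ℕ)
        (unsatBy side a (φ.clauses[j].take (t + 1))).toNat
        ((φ.clauses[j].length : ℤ) - (t + 1 : ℕ)) 0 0 0) φ.input o ω)
      (satUseLit.wt * M.size) := by
    refine Runs.block (by simp [satUseLit, Prog.IsBlock]) h.fits.one_le
      (h.small ho hA (by omega) ha ?_ ω) ?_
    · have := Nat.div_le_self a (2 ^ ((i : ℕ) / 2))
      generalize a / 2 ^ ((i : ℕ) / 2) = y at this ⊢
      simp only [List.mem_cons, List.not_mem_nil, or_false, forall_eq_or_imp, forall_eq]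
      omega
    · rw [hflag, ← satUseLit_flag _ hside]
      simp [satUseLit, Prog.ev, Expr.val, Expr.eqTest, outState_reg_succ, setReg_outState,
        KCNF.regs]
      congr 2
      simp only [List.cons.injEq, true_and, and_true]
      refine ⟨by ring, by ring⟩
  refine (r1.seq (r2.seq r3)).mono ?_
  generalize satReadLit.wt = a1, loopWt (.sub (.reg 12) (.const 1)) satHalve = a2,
    satUseLit.wt = a3, M.size = S
  have : 0 ≤ φ.n * (a1 * S + a3 * S) := Nat.zero_le _
  linarith

end

/-! ### Writing the vectors of a formula -/

section

variable {k : ℕ} {φ : KCNF k}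

/-- Reads the length of a clause. -/
def satClauseStart : Prog :=
  .seq (.assign 10 (.const 1)) (.seq (.assign 11 (.load (.sub (.const (-1)) (.reg 9))))
    (.assign 9 (.add (.reg 9) (.const 1))))

/-- Writes the coordinate for a clause. -/
def satClauseEnd : Prog :=
  .seq (emit (.reg 10)) (.seq (.assign 10 (.const 0)) (.assign 8 (.sub (.reg 8) (.const 1))))

/-- Handles a clause. -/
def satClause : Prog := .seq satClauseStart (.seq (.loop (.reg 11) satLit) satClauseEnd)

/-- `K` precedes `k` and `φ` because it is a weight of the program. The flag starts at 1, as an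
empty clause is unsatisfied, and register 8 counts the clauses down to 0. -/
theorem runs_satClause : ∃ K, ∀ {k : ℕ} {φ : KCNF k} {M : ℕ} {F o : List ℤ}, φ.Ctx M F →
    ∀ {A side a j : ℕ} (hj : j < φ.clauses.length),
    o ++ [((unsatBy side a φ.clauses[j]).toNat : ℤ)] <+: F → A ≤ M → side < 2 → a ≤ M →
    ∀ ω : ℕ → Bool,
    Runs satClause
      (outState (φ.regs A side a ((φ.clauses.length : ℤ) - j) (φ.pos j) 0 0 0 0 0) φ.input o ω)
      (outState (φ.regs A side a ((φ.clauses.length : ℤ) - (j + 1 : ℕ)) (φ.pos (j + 1)) 0 0 0 0 0)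
        φ.input (o ++ [((unsatBy side a φ.clauses[j]).toNat : ℤ)]) ω)
      ((k + 1) * (φ.n + 1) * (K * M.size)) := by
  refine ⟨satClauseStart.wt +
    ((satReadLit.wt + loopWt (.sub (.reg 12) (.const 1)) satHalve + satUseLit.wt) +
      ((Expr.reg 11).wt + 1)) + satClauseEnd.wt,
    fun {k φ M F o} h {A side a j} hj hF hA hside ha ω => ?_⟩
  have ho : o <+: F := (List.prefix_append _ _).trans hF
  have hm := h.m_le
  have hk : φ.clauses[j].length ≤ k := φ.size_le _ (List.getElem_mem hj)
  have hkM := h.k_le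
  have hpos := φ.pos_succ hj
  have hposM := (φ.pos_le (j + 1)).trans h.len_le
  have hfl : ∀ t, ((unsatBy side a (φ.clauses[j].take t)).toNat : ℤ).natAbs ≤ M := fun t => by
    have := Bool.toNat_le (unsatBy side a (φ.clauses[j].take t))
    have := h.fits.one_le
    omega
  have hsm : ∀ t ≤ φ.clauses[j].length,
      Small M (outState (φ.regs A side a ((φ.clauses.length : ℤ) - j) (φ.pos j + 1 + t : ℕ)
        (unsatBy side a (φ.clauses[j].take t)).toNat ((φ.clauses[j].length : ℤ) - t) 0 0 0)
        φ.input o ω) := fun t ht => by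
    refine h.small ho hA (by omega) ha ?_ ω
    have := hfl t
    simp only [List.mem_cons, List.not_mem_nil, or_false, forall_eq_or_imp, forall_eq]
    omega
  have r1 : Runs satClauseStart
      (outState (φ.regs A side a ((φ.clauses.length : ℤ) - j) (φ.pos j) 0 0 0 0 0) φ.input o ω)
      (outState (φ.regs A side a ((φ.clauses.length : ℤ) - j) (φ.pos j + 1 + 0 : ℕ)
        (unsatBy side a (φ.clauses[j].take 0)).toNat
        ((φ.clauses[j].length : ℤ) - (0 : ℕ)) 0 0 0) φ.input o ω)
      (satClauseStart.wt * M.size) := by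
    refine Runs.block (by simp [satClauseStart, Prog.IsBlock]) h.fits.one_le
      (h.small ho hA (by omega) ha ?_ ω) ?_
    · simp only [List.mem_cons, List.not_mem_nil, or_false, forall_eq_or_imp, forall_eq]
      omega
    · simp [satClauseStart, Prog.ev, Expr.val, outState_reg_succ, setReg_outState, KCNF.regs,
        outState_mem, splitMem_neg _ _ rfl, φ.input_pos hj, unsatBy]
  have r2 := Runs.loop (e := .reg 11) (p := satLit) h.fits.one_le _ φ.clauses[j].length
    (fun t ht => by simp [Expr.val, outState_reg_succ, KCNF.regs]; omega)
    (by simp [Expr.val, outState_reg_succ, KCNF.regs]) hsm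
    (fun t ht => runs_satLit h ho hA hside ha (by omega) hj ht ω) rfl rfl
  have r3 : Runs satClauseEnd
      (outState (φ.regs A side a ((φ.clauses.length : ℤ) - j)
        (φ.pos j + 1 + φ.clauses[j].length : ℕ)
        (unsatBy side a (φ.clauses[j].take φ.clauses[j].length)).toNat
        ((φ.clauses[j].length : ℤ) - φ.clauses[j].length) 0 0 0) φ.input o ω)
      (outState (φ.regs A side a ((φ.clauses.length : ℤ) - (j + 1 : ℕ)) (φ.pos (j + 1)) 0 0 0 0 0)
        φ.input (o ++ [((unsatBy side a φ.clauses[j]).toNat : ℤ)]) ω)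
      (satClauseEnd.wt * M.size) := by
    refine Runs.block (by simp [satClauseEnd, Prog.IsBlock, isBlock_emit]) h.fits.one_le
      (hsm _ le_rfl) ?_
    rw [List.take_length, hpos]
    simp [satClauseEnd, Prog.ev, ev_emit, Expr.val, outState_reg_succ, setReg_outState, KCNF.regs]
    congr 2
    simp only [List.cons.injEq, true_and, and_true]
    ring
  refine (r1.seq (r2.seq r3)).mono ?_
  generalize satClauseStart.wt = a1,
    satReadLit.wt + loopWt (.sub (.reg 12) (.const 1)) satHalve + satUseLit.wt = a2,
    (Expr.reg 11).wt = a3, satClauseEnd.wt = a4, M.size = S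
  have q1 : (φ.clauses[j].length + 1) * ((φ.n + 1) * (a2 * S) + (a3 + 1) * S) ≤
      (k + 1) * ((φ.n + 1) * (a2 * S) + (φ.n + 1) * ((a3 + 1) * S)) := by
    exact Nat.mul_le_mul (by omega)
      (Nat.add_le_add_left (Nat.le_mul_of_pos_left _ (Nat.succ_pos _)) _)
  have q2 : 1 ≤ (k + 1) * (φ.n + 1) := Nat.mul_pos (by omega) (by omega)
  have q3 := Nat.mul_le_mul_right (a1 * S + a4 * S) q2
  linarith

/-- The vectors are numbered `A = side · 2^half + a`, so quotient and remainder recover the side and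
the half assignment. -/
theorem KCNF.bit_toOV (φ : KCNF k) {A j : ℕ} (hA : A < 2 ^ φ.half + 2 ^ φ.half)
    (hj : j < φ.clauses.length) :
    φ.toOV.bit A j = unsatBy (A / 2 ^ φ.half) (A % 2 ^ φ.half) φ.clauses[j] := by
  have hP : 0 < 2 ^ φ.half := by positivity
  have hn : φ.toOV.n = 2 ^ φ.half := rfl
  have hd : φ.toOV.d = φ.clauses.length + 1 := rfl
  rw [OVInstance.bit, dif_pos (by omega)]
  split_ifs with h1 h2
  · rw [hn] at h1
    rw [Nat.div_eq_of_lt h1, Nat.mod_eq_of_lt h1]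
    simp [KCNF.toOV, hj]
  · rw [hn] at h1 h2
    have e1 : A / 2 ^ φ.half = 1 := by
      rw [Nat.div_eq_iff hP]
      omega
    have e2 : A % 2 ^ φ.half = A - 2 ^ φ.half := by
      rw [Nat.mod_eq_sub_mod (by omega), Nat.mod_eq_of_lt h2]
    rw [e1, e2]
    simp [KCNF.toOV, hj]
    rfl
  · omega

theorem KCNF.bit_toOV_last (φ : KCNF k) (A : ℕ) : φ.toOV.bit A φ.clauses.length = false := by
  rw [OVInstance.bit]
  split_ifs <;> simp [KCNF.toOV]

/-- Decodes the number of a vector. -/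
def satVecStart : Prog :=
  .seq (.assign 6 (.div (.reg 4) (.reg 5))) (.seq (.assign 7 (.sub (.reg 4) (.mul (.reg 6) (.reg 5))))
    (.seq (.assign 8 (.reg 2)) (.assign 9 (.const 2))))

/-- Writes the last coordinate of a vector. -/
def satVecEnd : Prog :=
  .seq (emit (.const 0)) (.seq (.assign 4 (.add (.reg 4) (.const 1)))
    (.seq (.assign 6 (.const 0)) (.seq (.assign 7 (.const 0)) (.assign 9 (.const 0)))))

/-- Writes a vector. -/
def satVec : Prog := .seq satVecStart (.seq (.loop (.reg 8) satClause) satVecEnd)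

/-- The code of a vector. -/
def KCNF.vecCode (φ : KCNF k) (A : ℕ) : List ℤ :=
  (List.range φ.toOV.d).map fun l => ((φ.toOV.bit A l).toNat : ℤ)

theorem KCNF.vecCode_eq (φ : KCNF k) (A : ℕ) : φ.vecCode A =
    ((List.range φ.clauses.length).flatMap fun l => [((φ.toOV.bit A l).toNat : ℤ)]) ++ [0] := by
  have hd : φ.toOV.d = φ.clauses.length + 1 := rfl
  rw [KCNF.vecCode, hd, List.range_succ, List.map_append, List.map_singleton, φ.bit_toOV_last]
  simp [List.map_eq_flatMap]

/-- Each vector is produced by rereading the whole formula, whence one factor for each of the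
clauses, the literals of a clause and the halving steps of a literal. -/
theorem runs_satVec : ∃ K, ∀ {k : ℕ} {φ : KCNF k} {M : ℕ} {F o : List ℤ}, φ.Ctx M F →
    ∀ {A : ℕ}, A < 2 ^ φ.half + 2 ^ φ.half → o ++ φ.vecCode A <+: F → ∀ ω : ℕ → Bool,
    Runs satVec (outState (φ.regs A 0 0 0 0 0 0 0 0 0) φ.input o ω)
      (outState (φ.regs (A + 1) 0 0 0 0 0 0 0 0 0) φ.input (o ++ φ.vecCode A) ω)
      ((φ.clauses.length + 1) * ((k + 1) * (φ.n + 1)) * (K * M.size)) := by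
  obtain ⟨K, hK⟩ := runs_satClause
  refine ⟨satVecStart.wt + (K + ((Expr.reg 8).wt + 1)) + satVecEnd.wt,
    fun {k φ M F o} h {A} hA hF ω => ?_⟩
  have hpow := h.pow_le
  have hm := h.m_le
  have hP : 0 < 2 ^ φ.half := by positivity
  have hside : A / 2 ^ φ.half < 2 := Nat.div_lt_of_lt_mul (by omega)
  have hone := h.fits.one_le
  have ha : A % 2 ^ φ.half < 2 ^ φ.half := Nat.mod_lt _ hP
  have hlen := h.len_le
  have hF' : o ++ ((List.range φ.clauses.length).flatMap
      fun l => [((φ.toOV.bit A l).toNat : ℤ)]) <+: F := by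
    refine List.IsPrefix.trans ?_ hF
    rw [KCNF.vecCode_eq, ← List.append_assoc]
    exact List.prefix_append _ _
  have ho : o <+: F := (List.prefix_append _ _).trans hF
  have h2 : 2 ≤ M := by have := h.n_le; omega
  have r1 : Runs satVecStart (outState (φ.regs A 0 0 0 0 0 0 0 0 0) φ.input o ω)
      (outState (φ.regs A (A / 2 ^ φ.half) (A % 2 ^ φ.half) ((φ.clauses.length : ℤ) - (0 : ℕ))
        (φ.pos 0) 0 0 0 0 0) φ.input o ω) (satVecStart.wt * M.size) := by
    refine Runs.block (by simp [satVecStart, Prog.IsBlock]) hone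
      (h.small ho (by omega) (by omega) (by omega) (by simp) ω) ?_
    rw [φ.pos_zero]
    simp [satVecStart, Prog.ev, Expr.val, outState_reg_succ, setReg_outState, KCNF.regs]
    congr 2
    simp only [List.cons.injEq, true_and, and_true]
    -- The program obtains the remainder as `A - (A / P) P`.
    rw [Int.emod_def]
    ring
  have hl : ∀ j ≤ φ.clauses.length, ∀ v ∈ φ.regs A (A / 2 ^ φ.half) (A % 2 ^ φ.half)
      ((φ.clauses.length : ℤ) - j) (φ.pos j) 0 0 0 0 0, v.natAbs ≤ M := by
    intro j hj
    have := φ.pos_le j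
    have := h.n_le
    generalize A / 2 ^ φ.half = x at *
    generalize A % 2 ^ φ.half = y at *
    generalize hPP : 2 ^ φ.half = P at *
    simp only [KCNF.regs, List.mem_cons, List.not_mem_nil, or_false, forall_eq_or_imp, forall_eq,
      hPP]
    omega
  have r2 := Runs.emit_loop (e := .reg 8) (p := satClause) h.fits (ω := ω)
    (fun j => φ.regs A (A / 2 ^ φ.half) (A % 2 ^ φ.half) ((φ.clauses.length : ℤ) - j)
      (φ.pos j) 0 0 0 0 0) _ φ.clauses.length hl hF'
    (fun j hj o => by simp [Expr.val, outState_reg_succ, KCNF.regs]; omega)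
    (fun o => by simp [Expr.val, outState_reg_succ, KCNF.regs])
    (fun j hj o ho => by
      rw [φ.bit_toOV hA hj] at ho ⊢
      exact hK h hj ho (by omega) hside (by omega) ω) rfl
  have r3 : Runs satVecEnd
      (outState (φ.regs A (A / 2 ^ φ.half) (A % 2 ^ φ.half)
        ((φ.clauses.length : ℤ) - φ.clauses.length) (φ.pos φ.clauses.length) 0 0 0 0 0) φ.input
        (o ++ ((List.range φ.clauses.length).flatMap fun l => [((φ.toOV.bit A l).toNat : ℤ)])) ω)
      (outState (φ.regs (A + 1) 0 0 0 0 0 0 0 0 0) φ.input (o ++ φ.vecCode A) ω)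
      (satVecEnd.wt * M.size) := by
    refine Runs.block (by simp [satVecEnd, Prog.IsBlock, isBlock_emit]) hone
      (h.fits.small hF' (hl _ le_rfl) ω) ?_
    rw [KCNF.vecCode_eq]
    simp [satVecEnd, Prog.ev, ev_emit, Expr.val, outState_reg_succ, setReg_outState, KCNF.regs]
  refine (r1.seq (r2.seq r3)).mono ?_
  generalize satVecStart.wt = a1, (Expr.reg 8).wt = a3, satVecEnd.wt = a4, M.size = S
  have q2 : 1 ≤ (k + 1) * (φ.n + 1) := Nat.mul_pos (by omega) (by omega)
  generalize (k + 1) * (φ.n + 1) = X at q2 ⊢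
  have q3 := Nat.mul_le_mul_left (φ.clauses.length + 1) (Nat.mul_le_mul_right ((a3 + 1) * S) q2)
  have q4 : 1 ≤ (φ.clauses.length + 1) * X := Nat.mul_pos (by omega) (by omega)
  have q5 := Nat.mul_le_mul_right (a1 * S + a4 * S) q4
  linarith

/-! ### The whole program -/

/-- Reads the numbers of variables and of clauses. -/
def satSetup : Prog :=
  .seq (.assign 1 (.load (.const 0))) (.seq (.assign 2 (.load (.const 1)))
    (.seq (.assign 3 (.const 2)) (.assign 8 (.reg 2))))

/-- Skips a clause. -/
def satSkipClause : Prog :=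
  .seq (.assign 3 (.add (.reg 3) (.add (.const 1) (.load (.reg 3)))))
    (.assign 8 (.sub (.reg 8) (.const 1)))

/-- Prepares the computation of a power of `2`. -/
def satPowStart : Prog :=
  .seq (.assign 4 (.const 0)) (.seq (.assign 5 (.const 1)) (.assign 12 (.reg 1)))

/-- Doubles register 5. -/
def satDouble : Prog :=
  .seq (.assign 5 (.mul (.reg 5) (.const 2))) (.assign 12 (.sub (.reg 12) (.const 2)))

/-- Writes the number and the dimension of the vectors. -/
def satWriteHead : Prog :=
  .seq (.assign 12 (.const 0)) (.seq (emit (.reg 5)) (emit (.add (.reg 2) (.const 1))))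

/-- Turns a formula into an instance of Orthogonal Vectors. -/
def satToOVProg : Prog :=
  .seq satSetup (.seq (.loop (.reg 8) satSkipClause) (.seq moveInput (.seq satPowStart
    (.seq (.loop (.reg 12) satDouble) (.seq satWriteHead
      (.seq (.loop (.sub (.add (.reg 5) (.reg 5)) (.reg 4)) satVec)
        (.seq (.assign 4 (.const 0)) (.seq clearInput clearSixRegs))))))))

/-- A bound on the numbers that occur. -/
def KCNF.bound (φ : KCNF k) : ℕ :=
  4 * (2 ^ φ.half * ((φ.clauses.length + 1) * ((k + 1) * (φ.n + 1))))

/-- The largest quantities are the output length `2 + 2 · 2^half (m+1)` and the input length, at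
most `2 + m(k+1)`, where `m` is the number of clauses. The factor 4 in `KCNF.bound` takes up the
additive constants. -/
theorem KCNF.ctx (φ : KCNF k) : φ.Ctx φ.bound φ.toOV.encode := by
  have hP : 1 ≤ 2 ^ φ.half := Nat.one_le_two_pow
  have hn : φ.toOV.n = 2 ^ φ.half := rfl
  have hd : φ.toOV.d = φ.clauses.length + 1 := rfl
  have b1 : (φ.clauses.length + 1) * ((k + 1) * (φ.n + 1)) ≤
      2 ^ φ.half * ((φ.clauses.length + 1) * ((k + 1) * (φ.n + 1))) :=
    Nat.le_mul_of_pos_left _ hP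
  have b2 : (k + 1) * (φ.n + 1) ≤ (φ.clauses.length + 1) * ((k + 1) * (φ.n + 1)) :=
    Nat.le_mul_of_pos_left _ (by omega)
  have b3 : φ.n + 1 ≤ (k + 1) * (φ.n + 1) := Nat.le_mul_of_pos_left _ (by omega)
  have b4 : k + 1 ≤ (k + 1) * (φ.n + 1) := Nat.le_mul_of_pos_right _ (by omega)
  have b5 : (φ.clauses.length + 1) * (k + 1) ≤
      (φ.clauses.length + 1) * ((k + 1) * (φ.n + 1)) := Nat.mul_le_mul_left _ b4
  have b6 : φ.clauses.length + 1 ≤ (φ.clauses.length + 1) * (k + 1) :=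
    Nat.le_mul_of_pos_right _ (by omega)
  have b7 : 2 ^ φ.half * (φ.clauses.length + 1) ≤
      2 ^ φ.half * ((φ.clauses.length + 1) * ((k + 1) * (φ.n + 1))) :=
    Nat.mul_le_mul_left _ (by omega)
  have b8 : 2 ^ φ.half ≤ 2 ^ φ.half * (φ.clauses.length + 1) :=
    Nat.le_mul_of_pos_right _ (by omega)
  have hlen := φ.length_encode_le
  have b9 : (φ.clauses.length + 1) * (k + 1) = φ.clauses.length * (k + 1) + k + 1 := by ring
  refine ⟨⟨?_, fun a => ?_, fun v hv => ?_, ?_⟩, ?_, ?_, ?_, ?_, ?_⟩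
  · rw [KCNF.bound]; omega
  · have := φ.natAbs_input_le a
    rw [KCNF.bound]
    omega
  · rw [φ.toOV.encode_eq, hn, hd] at hv
    simp only [List.mem_append, List.mem_flatMap, List.mem_map, List.mem_cons, List.not_mem_nil,
      or_false] at hv
    rw [KCNF.bound]
    rcases hv with (rfl | rfl) | ⟨c, -, l, -, rfl⟩
    · rw [Int.natAbs_natCast]; omega
    · rw [Int.natAbs_natCast]; omega
    · have := φ.toOV.bit_natAbs_le c l
      omega
  · rw [φ.toOV.length_encode, hn, hd, KCNF.bound, add_mul]
    omega
  all_goals rw [KCNF.bound]; omega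

/-- The input length is not a function of its first two numbers, so the clauses are skipped through
once to find it. The power `2^half` is made by doubling while `n` is lowered by 2, which takes
`⌈n/2⌉` rounds. The `2 · 2^half` vectors dominate the cost. -/
theorem runs_satToOVProg : ∃ K, ∀ {k : ℕ} (φ : KCNF k) (ω : ℕ → Bool),
    Runs satToOVProg (initState φ.encode ω) (initState φ.toOV.encode ω)
      (K * φ.bound * φ.bound.size) := by
  obtain ⟨K, hK⟩ := runs_satVec
  refine ⟨satSetup.wt + loopWt (.reg 8) satSkipClause +
    loopWt (.sub (.reg 3) (.reg 4)) moveCell + satPowStart.wt + loopWt (.reg 12) satDouble +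
    satWriteHead.wt + (K + ((Expr.sub (.add (.reg 5) (.reg 5)) (.reg 4)).wt + 1)) +
    (Prog.assign 4 (.const 0)).wt + loopWt (.sub (.reg 3) (.reg 4)) clearCell +
    clearSixRegs.wt, fun {k} φ ω => ?_⟩
  have h := φ.ctx
  have hOV := φ.toOV.encode_eq
  have hn : φ.toOV.n = 2 ^ φ.half := rfl
  have hd : φ.toOV.d = φ.clauses.length + 1 := rfl
  have hbound : φ.bound = 4 * (2 ^ φ.half * ((φ.clauses.length + 1) * ((k + 1) * (φ.n + 1)))) := rfl
  have hY : 1 ≤ (φ.clauses.length + 1) * ((k + 1) * (φ.n + 1)) := by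
    have : 0 < (k + 1) * (φ.n + 1) := by positivity
    exact Nat.mul_pos (by omega) this
  have hPone : 1 ≤ 2 ^ φ.half := Nat.one_le_two_pow
  have hPhalf : φ.half < 2 ^ φ.half := Nat.lt_two_pow_self
  have hL3 : φ.encode.length + 1 ≤ φ.bound := by
    have b1 := φ.length_encode_le
    have b2 : (φ.clauses.length + 1) * (k + 1) ≤
        (φ.clauses.length + 1) * ((k + 1) * (φ.n + 1)) :=
      Nat.mul_le_mul_left _ (Nat.le_mul_of_pos_right _ (by omega))
    have b3 : (φ.clauses.length + 1) * (k + 1) = φ.clauses.length * (k + 1) + k + 1 := by ring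
    have b4 : (φ.clauses.length + 1) * ((k + 1) * (φ.n + 1)) ≤
        2 ^ φ.half * ((φ.clauses.length + 1) * ((k + 1) * (φ.n + 1))) :=
      Nat.le_mul_of_pos_left _ hPone
    omega
  have hm3 : φ.clauses.length + 1 ≤ φ.bound := by
    have b1 : φ.clauses.length + 1 ≤ (φ.clauses.length + 1) * ((k + 1) * (φ.n + 1)) :=
      Nat.le_mul_of_pos_right _ (by positivity)
    have b4 : (φ.clauses.length + 1) * ((k + 1) * (φ.n + 1)) ≤
        2 ^ φ.half * ((φ.clauses.length + 1) * ((k + 1) * (φ.n + 1))) :=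
      Nat.le_mul_of_pos_left _ hPone
    omega
  have hP3 : 2 ^ φ.half + 2 ^ φ.half + 1 ≤ 4 * 2 ^ φ.half := by omega
  -- From here on the polynomial factor, the output and the bound are opaque, so that arithmetic
  -- sees them as atoms.
  replace hK := @hK k φ
  generalize (φ.clauses.length + 1) * ((k + 1) * (φ.n + 1)) = Y at hK hbound hY
  generalize hF : φ.toOV.encode = F at *
  rw [hn] at hOV
  change F = _ ++ (List.range (2 ^ φ.half + 2 ^ φ.half)).flatMap φ.vecCode at hOV
  generalize φ.bound = M at *
  have hone := h.fits.one_le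
  have hnM := h.n_le
  have hmM := h.m_le
  have hLM := h.len_le
  have hPM := h.pow_le
  have hf0 : ∀ a, φ.encode.length ≤ a → φ.input a = 0 := fun a ha => by
    rw [KCNF.input, List.getD_eq_default _ _ ha]
  have e0 : φ.input 0 = φ.n := by simp [KCNF.input, φ.encode_eq]
  have e1 : φ.input 1 = φ.clauses.length := by simp [KCNF.input, φ.encode_eq]
  have r1 : Runs satSetup (initState φ.encode ω)
      (listState [0, φ.n, φ.clauses.length, φ.pos 0, 0, 0, 0, 0,
        (φ.clauses.length : ℤ) - (0 : ℕ), 0, 0, 0, 0, 0, 0] (splitMem (fun _ => 0) φ.input) ω)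
      (satSetup.wt * M.size) := by
    rw [initState_eq, ← listState_eq_nil (l := [0, 0, 0, 0, 0, 0, 0, 0, 0, 0, 0, 0, 0, 0, 0])
      (by simp)]
    refine Runs.block (by simp [satSetup, Prog.IsBlock]) hone
      (Small.listState (by simp) (by simp) h.fits.input ω) ?_
    have e0' : splitMem (fun _ => 0) φ.input 0 = φ.n := (splitMem_nonneg _ _ (k := 0) rfl).trans e0
    have e1' : splitMem (fun _ => 0) φ.input 1 = φ.clauses.length :=
      (splitMem_nonneg _ _ (k := 1) rfl).trans e1
    change satSetup.ev (listState _ (splitMem (fun _ => 0) φ.input) ω) = _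
    simp [satSetup, Prog.ev, Expr.val, listState_reg, listState_mem, setReg_listState, e0', e1',
      φ.pos_zero]
  have r2 : Runs (.loop (.reg 8) satSkipClause)
      (listState [0, φ.n, φ.clauses.length, φ.pos 0, 0, 0, 0, 0,
        (φ.clauses.length : ℤ) - (0 : ℕ), 0, 0, 0, 0, 0, 0] (splitMem (fun _ => 0) φ.input) ω)
      (listState [0, φ.n, φ.clauses.length, φ.encode.length, 0, 0, 0, 0, 0, 0, 0, 0, 0, 0, 0]
        (splitMem (fun _ => 0) φ.input) ω)
      ((φ.clauses.length + 1) * (loopWt (.reg 8) satSkipClause * M.size)) := by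
    refine Runs.loop_block (M := M) (by simp [satSkipClause, Prog.IsBlock]) hone
      (fun j => listState [0, φ.n, φ.clauses.length, φ.pos j, 0, 0, 0, 0,
        (φ.clauses.length : ℤ) - j, 0, 0, 0, 0, 0, 0] (splitMem (fun _ => 0) φ.input) ω)
      φ.clauses.length (fun j hj => ?_) ?_ (fun j hj => ?_) (fun j hj => ?_) rfl ?_
    · simp [Expr.val, listState_reg]; omega
    · simp [Expr.val, listState_reg]
    · refine Small.listState ?_ (by simp) h.fits.input ω
      have := φ.pos_le j
      simp
      omega
    · rw [φ.pos_succ hj]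
      simp [satSkipClause, Prog.ev, Expr.val, listState_reg, listState_mem, setReg_listState,
        splitMem_nonneg _ _ rfl, φ.input_pos hj]
      congr 2
      simp only [List.cons.injEq, true_and, and_true]
      refine ⟨by ring, by ring⟩
    · rw [φ.pos_length, sub_self]
  have r3 := runs_moveInput (M := M) (x := 0) (y := φ.n) (z := φ.clauses.length)
    (l := [0, 0, 0, 0, 0, 0, 0, 0, 0, 0]) hone hLM (by simp; omega) h.fits.input hf0 ω
  have r4 : Runs satPowStart
      (outState [φ.n, φ.clauses.length, φ.encode.length, φ.encode.length,
        0, 0, 0, 0, 0, 0, 0, 0, 0, 0] φ.input [] ω)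
      (outState [φ.n, φ.clauses.length, φ.encode.length, 0, (2 ^ 0 : ℕ),
        0, 0, 0, 0, 0, 0, (φ.n : ℤ) - 2 * (0 : ℕ), 0, 0] φ.input [] ω)
      (satPowStart.wt * M.size) := by
    refine Runs.block (by simp [satPowStart, Prog.IsBlock]) hone
      (h.fits.small List.nil_prefix (by simp; omega) ω) ?_
    simp [satPowStart, Prog.ev, Expr.val, outState_reg_succ, setReg_outState]
  have hdouble : ∀ i ≤ φ.half, Small M
      (outState [φ.n, φ.clauses.length, φ.encode.length, 0, (2 ^ i : ℕ),
        0, 0, 0, 0, 0, 0, (φ.n : ℤ) - 2 * i, 0, 0] φ.input [] ω) := fun i hi => by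
    refine h.fits.small List.nil_prefix ?_ ω
    have b1 : 2 ^ i ≤ 2 ^ φ.half := Nat.pow_le_pow_right (by norm_num) hi
    have b2 : φ.half = (φ.n + 1) / 2 := rfl
    generalize 2 ^ i = y at *
    simp only [List.mem_cons, List.not_mem_nil, or_false, forall_eq_or_imp, forall_eq]
    omega
  have r5 := Runs.loop_block (e := .reg 12) (p := satDouble) (by simp [satDouble, Prog.IsBlock])
    hone _ φ.half (fun i hi => by
      have b2 : φ.half = (φ.n + 1) / 2 := rfl
      simp [Expr.val, outState_reg_succ]
      omega) (by
      have b2 : φ.half = (φ.n + 1) / 2 := rfl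
      simp [Expr.val, outState_reg_succ]
      omega) hdouble (fun i hi => by
      simp [satDouble, Prog.ev, Expr.val, outState_reg_succ, setReg_outState, pow_succ]
      ring_nf) rfl rfl
  have r6 : Runs satWriteHead
      (outState [φ.n, φ.clauses.length, φ.encode.length, 0, (2 ^ φ.half : ℕ),
        0, 0, 0, 0, 0, 0, (φ.n : ℤ) - 2 * φ.half, 0, 0] φ.input [] ω)
      (outState (φ.regs 0 0 0 0 0 0 0 0 0 0) φ.input
      [((2 ^ φ.half : ℕ) : ℤ), (φ.toOV.d : ℤ)] ω) (satWriteHead.wt * M.size) := by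
    refine Runs.block (by simp [satWriteHead, Prog.IsBlock, isBlock_emit]) hone
      (hdouble _ le_rfl) ?_
    simp [satWriteHead, Prog.ev, ev_emit, Expr.val, outState_reg_succ, setReg_outState, KCNF.regs,
      hd]
  have hl : ∀ A ≤ 2 ^ φ.half + 2 ^ φ.half, ∀ v ∈ φ.regs A 0 0 0 0 0 0 0 0 0, v.natAbs ≤ M := by
    intro A hA
    generalize hPP : 2 ^ φ.half = P at *
    simp only [KCNF.regs, List.mem_cons, List.not_mem_nil, or_false, forall_eq_or_imp, forall_eq,
      hPP]
    omega
  have r7 := Runs.emit_loop (e := .sub (.add (.reg 5) (.reg 5)) (.reg 4)) (p := satVec) h.fits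
    (ω := ω) (fun A => φ.regs A 0 0 0 0 0 0 0 0 0) φ.vecCode (2 ^ φ.half + 2 ^ φ.half) hl
    (o := [((2 ^ φ.half : ℕ) : ℤ), (φ.toOV.d : ℤ)]) (by rw [hOV]) (fun A hA o => by
      simp only [Expr.val, outState_reg_succ, KCNF.regs, List.getD_cons_succ, List.getD_cons_zero]
      omega)
    (fun o => by
      simp [Expr.val, outState_reg_succ, KCNF.regs])
    (fun A hA o ho => hK h hA ho ω) rfl
  rw [← hOV] at r7
  have r8 : Runs (.assign 4 (.const 0))
      (outState (φ.regs (2 ^ φ.half + 2 ^ φ.half) 0 0 0 0 0 0 0 0 0) φ.input F ω)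
      (outState (φ.regs 0 0 0 0 0 0 0 0 0 0) φ.input F ω)
      ((Prog.assign 4 (.const 0)).wt * M.size) := by
    refine Runs.block (by simp [Prog.IsBlock]) hone
      (h.fits.small List.prefix_rfl (hl _ le_rfl) ω) ?_
    simp [Prog.ev, Expr.val, setReg_outState, KCNF.regs]
  have hl' : ∀ v ∈ [((2 ^ φ.half : ℕ) : ℤ), 0, 0, 0, 0, 0, 0, 0, 0, 0], v.natAbs ≤ M := by
    generalize 2 ^ φ.half = P at *
    simp only [List.mem_cons, List.not_mem_nil, or_false, forall_eq_or_imp, forall_eq]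
    omega
  have hFM := h.fits.length
  have hl'' : ∀ v ∈ [(F.length : ℤ), φ.n, φ.clauses.length], v.natAbs ≤ M := by
    simp only [List.mem_cons, List.not_mem_nil, or_false, forall_eq_or_imp, forall_eq]
    omega
  have r9 := runs_clearInput (M := M) (x := F.length) (y := φ.n) (z := φ.clauses.length)
    (l := [((2 ^ φ.half : ℕ) : ℤ), 0, 0, 0, 0, 0, 0, 0, 0, 0])
    (g := fun k => F.getD k 0) hone hLM
    (fun v hv => (List.mem_append.1 hv).elim (hl'' v) (hl' v)) h.fits.input
    (natAbs_getD_le h.fits.output) hf0 ω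
  have r10 : Runs clearSixRegs
      (listState (F.length :: φ.n :: φ.clauses.length :: φ.encode.length :: φ.encode.length ::
        [((2 ^ φ.half : ℕ) : ℤ), 0, 0, 0, 0, 0, 0, 0, 0, 0])
        (splitMem (fun _ => 0) fun k => F.getD k 0) ω)
      (initState F ω) (clearSixRegs.wt * M.size) := by
    refine Runs.block (by simp [clearSixRegs, Prog.IsBlock]) hone
      (Small.listState (fun v hv => ?_) (by simp) (natAbs_getD_le h.fits.output) ω) ?_
    · rw [List.mem_cons, List.mem_cons, List.mem_cons, List.mem_cons, List.mem_cons] at hv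
      rcases hv with rfl | rfl | rfl | rfl | rfl | hv
      · simpa using hFM
      · simp; omega
      · simpa using hmM
      · simpa using hLM
      · simpa using hLM
      · exact hl' v hv
    · rw [initState_eq, ← listState_eq_nil (l := [0, 0, 0, 0, 0, 0, 0, 0, 0, 0, 0, 0, 0, 0, 0])
        (by simp)]
      simp [clearSixRegs, Prog.ev, Expr.val, setReg_listState]
  refine (r1.seq (r2.seq (r3.seq (r4.seq (r5.seq (r6.seq (r7.seq (r8.seq (r9.seq r10))))))))).mono ?_
  have q1 : φ.half + 1 ≤ M := by omega
  -- The main loop makes `2 · 2^half + 1 ≤ 4 · 2^half` tests, which is what the factor 4 of the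
  -- bound allows.
  have q2 : (2 ^ φ.half + 2 ^ φ.half + 1) * Y ≤ M := by
    rw [hbound, ← mul_assoc]
    exact Nat.mul_le_mul_right _ hP3
  have q3 : 2 ^ φ.half + 2 ^ φ.half + 1 ≤ M :=
    (Nat.le_mul_of_pos_right _ hY).trans q2
  generalize 2 ^ φ.half + 2 ^ φ.half + 1 = Q at q2 q3 ⊢
  generalize M.size = S
  generalize satSetup.wt = a1, loopWt (.reg 8) satSkipClause = a2,
    loopWt (.sub (.reg 3) (.reg 4)) moveCell = a3, satPowStart.wt = a4,
    loopWt (.reg 12) satDouble = a5, satWriteHead.wt = a6,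
    (Expr.sub (.add (.reg 5) (.reg 5)) (.reg 4)).wt = a7,
    (Prog.assign 4 (.const 0)).wt = a8, loopWt (.sub (.reg 3) (.reg 4)) clearCell = a9,
    clearSixRegs.wt = a10
  have := Nat.mul_le_mul_right (a2 * S) hm3
  have := Nat.mul_le_mul_right (a3 * S + a9 * S) hL3
  have := Nat.mul_le_mul_right (a5 * S) q1
  have := Nat.mul_le_mul_right (K * S) q2
  have := Nat.mul_le_mul_right ((a7 + 1) * S) q3
  have := Nat.mul_le_mul_right (a1 * S + a4 * S + a6 * S + a8 * S + a10 * S) hone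
  linarith

end

/-! ### Running time of the reduction from satisfiability -/

/-- The quotient of `n^p` by `(2^δ)^n` tends to 0 and so is bounded; passing from `n` to `n + 1`
costs a factor `2^δ`. -/
theorem exists_pow_le_mul_two_rpow (p : ℕ) {δ : ℝ} (hδ : 0 < δ) :
    ∃ G : ℝ, 0 ≤ G ∧ ∀ n : ℕ, ((n : ℝ) + 1) ^ p ≤ G * (2 : ℝ) ^ (δ * n) := by
  have hr : (1 : ℝ) < 2 ^ δ := Real.one_lt_rpow (by norm_num) hδ
  obtain ⟨G, hG⟩ := (tendsto_pow_const_div_const_pow_of_one_lt p hr).bddAbove_range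
  have hG' : ∀ n : ℕ, (n : ℝ) ^ p / ((2 : ℝ) ^ δ) ^ n ≤ G := fun n => hG ⟨n, rfl⟩
  have hG0 : 0 ≤ G := le_trans (by positivity) (hG' 0)
  refine ⟨G * 2 ^ δ, by positivity, fun n => ?_⟩
  have h := hG' (n + 1)
  rw [div_le_iff₀ (by positivity), pow_succ] at h
  push_cast at h
  rw [Real.rpow_mul (by norm_num), Real.rpow_natCast]
  linarith

/-- The polynomial factor in the size of the reduction. -/
def KCNF.poly {k : ℕ} (φ : KCNF k) : ℕ := (φ.clauses.length + 1) * ((k + 1) * (φ.n + 1))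

/-- The bound is `2^2 · 2^half · poly`, so it has at most `2 + half + poly` bits, and `half` is at
most `poly / 2`. -/
theorem KCNF.size_bound_le {k : ℕ} (φ : KCNF k) : φ.bound.size ≤ 3 * φ.poly := by
  have h1 : φ.n + 1 ≤ φ.poly :=
    (Nat.le_mul_of_pos_left _ (Nat.succ_pos k)).trans (Nat.le_mul_of_pos_left _ (Nat.succ_pos _))
  have h2 : φ.half = (φ.n + 1) / 2 := rfl
  refine le_trans (b := 2 + φ.half + φ.poly) ?_ (by omega)
  rw [Nat.size_le, pow_add, pow_add, KCNF.bound, ← KCNF.poly]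
  have := Nat.lt_two_pow_self (n := φ.poly)
  have hP : 0 < 2 ^ φ.half := by positivity
  nlinarith [Nat.mul_lt_mul_of_pos_left this hP]

/-- For fixed `k` this is polynomial in `n` by the count of distinct clauses. -/
theorem KCNF.poly_le {k : ℕ} (φ : KCNF k) :
    φ.poly ≤ 2 ^ (k + 1) * (k + 1) * (φ.n + 1) ^ (k + 1) := by
  have h1 : φ.clauses.length + 1 ≤ 2 ^ (k + 1) * (φ.n + 1) ^ k := by
    have h := φ.length_clauses_le
    have h2 : (2 * φ.n + 1) ^ k ≤ 2 ^ k * (φ.n + 1) ^ k := by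
      rw [← mul_pow]
      exact Nat.pow_le_pow_left (by omega) k
    have h3 : 1 ≤ 2 ^ k * (φ.n + 1) ^ k := Nat.mul_pos (by positivity) (by positivity)
    rw [pow_succ, mul_assoc, mul_comm 2, ← mul_assoc]
    omega
  calc φ.poly ≤ 2 ^ (k + 1) * (φ.n + 1) ^ k * ((k + 1) * (φ.n + 1)) := Nat.mul_le_mul_right _ h1
    _ = _ := by ring

/-- Orthogonal Vectors in time `n ^ (2 - ε) * poly(d)` gives satisfiability in time
`O(2 ^ ((1 - ε / 4) * n))`, for every clause size. -/
theorem ksat_solvable_of_ov {ε C : ℝ} {c : ℕ} (hε : 0 < ε) (hε1 : ε ≤ 1) (hC : 0 ≤ C)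
    (h : OV.SolvableInTime fun I : OVInstance => C * (I.n : ℝ) ^ (2 - ε) * (I.d : ℝ) ^ c) (k : ℕ) :
    ∃ C' : ℝ, (KSAT k).SolvableInTime fun φ : KCNF k =>
      C' * (2 : ℝ) ^ ((1 - ε / 4) * (φ.n : ℝ)) := by
  obtain ⟨K, hK⟩ := runs_satToOVProg
  -- OV saves `2^(εn/2)`; half of this, `2^(εn/4)`, is spent on the polynomial factor `poly^(c+2)`,
  -- where `c` comes from the dimension and 2 from the reduction.
  obtain ⟨G, hG0, hG⟩ := exists_pow_le_mul_two_rpow ((k + 1) * (c + 2)) (δ := ε / 4) (by positivity)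
  refine ⟨(24 * K + 2 * C) * ((2 ^ (k + 1) * (k + 1)) ^ (c + 2) * G), ?_⟩
  refine (h.of_reduction (P := KSAT k) KCNF.toOV KCNF.toOV_isYes_iff satToOVProg _
    hK).mono fun φ => ?_
  change KCNF k at φ
  have hY1 : (1 : ℝ) ≤ φ.poly := by
    have : 0 < φ.poly := Nat.mul_pos (by omega) (Nat.mul_pos (by omega) (by omega))
    exact_mod_cast this
  have hhalf : (φ.half : ℝ) ≤ ((φ.n : ℝ) + 1) / 2 := by
    have : 2 * φ.half ≤ φ.n + 1 := Nat.mul_div_le _ _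
    have : (2 : ℝ) * φ.half ≤ φ.n + 1 := by exact_mod_cast this
    linarith
  have hn0 : (0 : ℝ) ≤ φ.n := Nat.cast_nonneg _
  -- The `+ 1` pays for rounding `n / 2` up. That `2^half` itself fits under this bound needs `ε ≤
  -- 1`.
  have hpow2 : ∀ x : ℝ, x ≤ (1 - ε / 2) * φ.n + 1 →
      (2 : ℝ) ^ x ≤ 2 * 2 ^ ((1 - ε / 2) * (φ.n : ℝ)) := fun x hx => by
    calc (2 : ℝ) ^ x ≤ 2 ^ ((1 - ε / 2) * (φ.n : ℝ) + 1) :=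
          Real.rpow_le_rpow_of_exponent_le (by norm_num) hx
      _ = _ := by rw [Real.rpow_add_one (by norm_num), mul_comm]
  have hP : ((2 ^ φ.half : ℕ) : ℝ) ≤ 2 * 2 ^ ((1 - ε / 2) * (φ.n : ℝ)) := by
    have : ((2 ^ φ.half : ℕ) : ℝ) = (2 : ℝ) ^ (φ.half : ℝ) := by
      rw [Real.rpow_natCast]; push_cast; rfl
    rw [this]
    refine hpow2 _ ?_
    nlinarith
  have hP' : ((2 ^ φ.half : ℕ) : ℝ) ^ (2 - ε) ≤ 2 * 2 ^ ((1 - ε / 2) * (φ.n : ℝ)) := by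
    have : ((2 ^ φ.half : ℕ) : ℝ) = (2 : ℝ) ^ (φ.half : ℝ) := by
      rw [Real.rpow_natCast]; push_cast; rfl
    rw [this, ← Real.rpow_mul (by norm_num)]
    refine hpow2 _ ?_
    nlinarith
  have hm : ((φ.clauses.length + 1 : ℕ) : ℝ) ≤ φ.poly := by
    exact_mod_cast Nat.le_mul_of_pos_right _ (Nat.mul_pos (Nat.succ_pos k) (Nat.succ_pos φ.n))
  have hR : ((K * φ.bound * φ.bound.size : ℕ) : ℝ) ≤
      24 * K * (φ.poly : ℝ) ^ (c + 2) * 2 ^ ((1 - ε / 2) * (φ.n : ℝ)) := by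
    have h1 : (φ.bound.size : ℝ) ≤ 3 * φ.poly := by exact_mod_cast φ.size_bound_le
    have h2 : (φ.bound : ℝ) = 4 * (((2 ^ φ.half : ℕ) : ℝ) * φ.poly) := by
      rw [KCNF.bound, ← KCNF.poly]; push_cast; rfl
    rw [Nat.cast_mul, Nat.cast_mul, h2]
    calc (K : ℝ) * (4 * (((2 ^ φ.half : ℕ) : ℝ) * φ.poly)) * φ.bound.size
        ≤ K * (4 * ((2 * 2 ^ ((1 - ε / 2) * (φ.n : ℝ))) * φ.poly)) * (3 * φ.poly) := by gcongr
      _ = 24 * K * (φ.poly : ℝ) ^ 2 * 2 ^ ((1 - ε / 2) * (φ.n : ℝ)) := by ring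
      _ ≤ _ := by
        gcongr
        omega
  have hT : C * (φ.toOV.n : ℝ) ^ (2 - ε) * (φ.toOV.d : ℝ) ^ c ≤
      2 * C * (φ.poly : ℝ) ^ (c + 2) * 2 ^ ((1 - ε / 2) * (φ.n : ℝ)) := by
    change C * ((2 ^ φ.half : ℕ) : ℝ) ^ (2 - ε) * ((φ.clauses.length + 1 : ℕ) : ℝ) ^ c ≤ _
    calc C * ((2 ^ φ.half : ℕ) : ℝ) ^ (2 - ε) * ((φ.clauses.length + 1 : ℕ) : ℝ) ^ c
        ≤ C * (2 * 2 ^ ((1 - ε / 2) * (φ.n : ℝ))) * (φ.poly : ℝ) ^ c := by gcongr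
      _ ≤ C * (2 * 2 ^ ((1 - ε / 2) * (φ.n : ℝ))) * (φ.poly : ℝ) ^ (c + 2) := by
        gcongr
        omega
      _ = _ := by ring
  have hY : (φ.poly : ℝ) ^ (c + 2) ≤
      (2 ^ (k + 1) * (k + 1)) ^ (c + 2) * (G * 2 ^ (ε / 4 * (φ.n : ℝ))) := by
    have h1 : (φ.poly : ℝ) ≤ 2 ^ (k + 1) * (k + 1) * ((φ.n : ℝ) + 1) ^ (k + 1) := by
      exact_mod_cast φ.poly_le
    calc (φ.poly : ℝ) ^ (c + 2)
        ≤ (2 ^ (k + 1) * (k + 1) * ((φ.n : ℝ) + 1) ^ (k + 1)) ^ (c + 2) := by gcongr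
      _ = (2 ^ (k + 1) * (k + 1)) ^ (c + 2) * ((φ.n : ℝ) + 1) ^ ((k + 1) * (c + 2)) := by
        rw [mul_pow _ (((φ.n : ℝ) + 1) ^ (k + 1)), ← pow_mul]
      _ ≤ _ := by
        gcongr
        exact hG φ.n
  have hexp : (2 : ℝ) ^ (ε / 4 * (φ.n : ℝ)) * 2 ^ ((1 - ε / 2) * (φ.n : ℝ)) =
      2 ^ ((1 - ε / 4) * (φ.n : ℝ)) := by
    rw [← Real.rpow_add (by norm_num)]
    congr 1
    ring
  calc ((K * φ.bound * φ.bound.size : ℕ) : ℝ) + C * (φ.toOV.n : ℝ) ^ (2 - ε) * (φ.toOV.d : ℝ) ^ c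
      ≤ (24 * K + 2 * C) * ((φ.poly : ℝ) ^ (c + 2) * 2 ^ ((1 - ε / 2) * (φ.n : ℝ))) := by
        linarith
    _ ≤ (24 * K + 2 * C) * (((2 ^ (k + 1) * (k + 1)) ^ (c + 2) * (G * 2 ^ (ε / 4 * (φ.n : ℝ)))) *
        2 ^ ((1 - ε / 2) * (φ.n : ℝ))) := by gcongr
    _ = (24 * K + 2 * C) * ((2 ^ (k + 1) * (k + 1)) ^ (c + 2) * G) *
        ((2 : ℝ) ^ (ε / 4 * (φ.n : ℝ)) * 2 ^ ((1 - ε / 2) * (φ.n : ℝ))) := by ring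
    _ = _ := by rw [hexp]

end FineGrained

/-- If `2`-sparse linear regression in the Euclidean norm, with a `d × n` design matrix, is solved
in time `n ^ (2 - ε) * poly(d)` for some `ε > 0`, even with a further factor polynomial in the bit
length of the numbers, then the Orthogonal Vectors Hypothesis and SETH are false. -/
theorem mainTheorem5
    (h : ∃ ε : ℝ, 0 < ε ∧ ∃ (C : ℝ) (c : ℕ),
      (FineGrained.SLR 2).SolvableInTime fun I : FineGrained.SLRInstance =>
        C * (I.n : ℝ) ^ (2 - ε) * ((I.d : ℝ) * (I.bits : ℝ)) ^ c) :
    ¬ FineGrained.OVHypothesis ∧ ¬ FineGrained.SETH := by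
  obtain ⟨ε, hε, C, c, h⟩ := h
  obtain ⟨ε', hε', hε1, C', c', hC', hOV⟩ := FineGrained.ov_solvable_of_slr hε h
  refine ⟨fun hyp => hyp ⟨ε', hε', C', c', hOV⟩, fun seth => ?_⟩
  -- The saving `ε' / 4` does not depend on `k`, so it contradicts whatever `k` SETH provides.
  obtain ⟨k, -, hk⟩ := seth (ε' / 4) (by positivity)
  exact hk (FineGrained.ksat_solvable_of_ov hε' hε1 hC' hOV k)
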